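/- **Notation.** For an even integer $N\ge 1$ put $h=\sqrt2\,N^{-1/2}$ and $A_h=h\mathbb Z\cap[-\frac1h,\frac1h]$, and for $u:h\mathbb Z\to\mathbb C$ let $\|u\|_{\ell^2(h\mathbb Z)}^2=h\sum_{a\in h\mathbb Z}|u(a)|^2$. Write $\langle x\rangle=(1+x^2)^{1/2}$. For $n\in\mathbb N$ let $\Sigma^n(\mathbb R)$ be the space of $\psi\in L^2(\mathbb R)$ (complex valued) with $\|\psi\|_{\Sigma^n}:=\|\psi\|_{H^n(\mathbb R)}+\|\langle x\rangle^n\psi\|_{L^2(\mathbb R)}<\infty$. For $f$ with a continuous representative (e.g. $f\in H^1(\mathbb R)$), $\pi_hf:h\mathbb Z\to\mathbb C$ is the restriction of that representative to $h\mathbb Z$. Let $Hg=-g''+x^2g$ be the harmonic oscillator, and let $H_h$ be the operator $$H_hu(a)=-\tfrac1{h^2}\sqrt{(1+ah+h^2)(1-ah)}\,u(a+h)-\tfrac1{h^2}\sqrt{(1-ah+h^2)(1+ah)}\,u(a-h)+\Big(1+\tfrac2{h^2}\Big)u(a)$$ for $a\in A_h$, and $H_hu(a)=0$ for $a\in h\mathbb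 Z\setminus A_h$. Let $\rho_h(a)=\frac1{h2^N}\binom{N}{N/2+a/h}$ for $a\in A_h$ and $\rho_h(a)=0$ for $a\in h\mathbb Z\setminus A_h$. The scaled Kravchuk polynomials are defined by $k_{0,h}=1$, $k_{1,h}(x)=2x$ and $k_{n+1,h}(x)=2x\,k_{n,h}(x)-2n\big(1-h^2\tfrac{n-1}2\big)k_{n-1,h}(x)$ for $n\ge1$, and the Kravchuk functions, for $0\le n\le N$, by $$\varphi_{n,h}(a)=\frac1{h^n}\sqrt{\frac{(N-n)!}{N!\,n!}}\;k_{n,h}(a)\sqrt{\rho_h(a)},\qquad a\in h\mathbb Z.$$ The Hermite functions are $\psi_n(x)=\pi^{-1/4}2^{-n/2}(n!)^{-1/2}e^{-x^2/2}H_n(x)$, where $H_0=1$, $H_1(x)=2x$ and $H_{n+1}(x)=2xH_n(x)-2nH_{n-1}(x)$ for $n\ge1$. **Theorem 2.** (i) There exist constants $C$ and $N_0$ such that for all even $N\ge N_0$, with $h=\sqrt2\,N^{-1/2}$, and all $g\in\Sigma^5(\mathbb R)$, $$\|\pi_h(Hg)-H_h(\pi_hg)\|_{\ell^2(h\mathbb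 Z)}\le C\,h^2\,\|g\|_{\Sigma^5(\mathbb R)}.$$ (ii) For all $\delta\in(0,1)$ and $\sigma\ge0$ there exist constants $C$ and $N_0$ such that for all even $N\ge N_0$, with $h=\sqrt2\,N^{-1/2}$, $$\Big\|\langle a\rangle^\sigma\Big(\rho_h(a)-\tfrac1{\sqrt\pi}e^{-a^2}\Big)\Big\|_{\ell^2(h\mathbb Z)}\le C\,h^{2-\delta},$$ and, for all integers $0\le n\le\frac13\,\delta\,|\log h|$, $$\big\|\langle a\rangle^\sigma(\varphi_{n,h}-\pi_h\psi_n)\big\|_{\ell^2(h\mathbb Z)}\le C\,h^{2-\delta}.$$ -/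

import Mathlib

open MeasureTheory
open scoped ENNReal ContDiff

noncomputable section

namespace Kravchuk

/-- The Japanese bracket `⟨x⟩ = (1 + x²)^{1/2}`. -/
def japanese (x : ℝ) : ℝ := √(1 + x ^ 2)

/-! ### Weak derivatives, Sobolev spaces and weighted Sobolev spaces on the real line -/

/-- `v` is the `k`-th weak derivative of `g` on `ℝ`. -/
def IsWeakDeriv (k : ℕ) (g v : ℝ → ℂ) : Prop :=
  LocallyIntegrable v ∧
    ∀ φ : ℝ → ℝ, ContDiff ℝ ∞ φ → HasCompactSupport φ →
      ∫ x, iteratedDeriv k φ x • g x = (-1 : ℂ) ^ k * ∫ x, φ x • v x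

open Classical in
/-- A representative of the `k`-th weak derivative of `g` (unique up to a null set);
`0` if there is no weak derivative. -/
def weakDeriv (k : ℕ) (g : ℝ → ℂ) : ℝ → ℂ :=
  if H : ∃ v, IsWeakDeriv k g v then H.choose else 0

/-- `g ∈ Hⁿ(ℝ)`: `g` and its weak derivatives up to order `n` are in `L²(ℝ)`. -/
def MemSobolev (n : ℕ) (g : ℝ → ℂ) : Prop :=
  MemLp g 2 ∧ ∀ k ≤ n, ∃ v, MemLp v 2 ∧ IsWeakDeriv k g v

/-- The `Hⁿ(ℝ)` norm. -/
def sobolevNorm (n : ℕ) (g : ℝ → ℂ) : ℝ≥0∞ :=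
  (∑ k ∈ Finset.range (n + 1), eLpNorm (weakDeriv k g) 2 ^ 2) ^ (1 / 2 : ℝ)

/-- `g ∈ Σⁿ(ℝ)`: `g ∈ Hⁿ(ℝ)` and `⟨x⟩ⁿ g ∈ L²(ℝ)`. -/
def MemSigma (n : ℕ) (g : ℝ → ℂ) : Prop :=
  MemSobolev n g ∧ MemLp (fun x => japanese x ^ n • g x) 2

/-- The `Σⁿ(ℝ)` norm. -/
def sigmaNorm (n : ℕ) (g : ℝ → ℂ) : ℝ≥0∞ :=
  sobolevNorm n g + eLpNorm (fun x => japanese x ^ n • g x) 2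

/-- The harmonic oscillator `H g = -g'' + x² g`, the derivative being taken in the weak sense. -/
def harmonicOscillator (g : ℝ → ℂ) : ℝ → ℂ :=
  fun x => -weakDeriv 2 g x + (x : ℂ) ^ 2 * g x

/-! ### The grid `hℤ` -/

/-- The grid `hℤ`. -/
abbrev Grid (h : ℝ) : Type := AddSubgroup.zmultiples h

/-- The point `h` of the grid `hℤ`. -/
def step (h : ℝ) : Grid h := ⟨h, AddSubgroup.mem_zmultiples h⟩

/-- The norm of `ℓ²(hℤ)`, `‖u‖² = h ∑ |u(a)|²`, with value `∞` if `u ∉ ℓ²(hℤ)`. -/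
def ell2Norm (h : ℝ) (u : Grid h → ℂ) : ℝ≥0∞ :=
  (ENNReal.ofReal h * ∑' a : Grid h, ‖u a‖ₑ ^ 2) ^ (1 / 2 : ℝ)

open Classical in
/-- The continuous representative of a function defined almost everywhere
(`0` if there is none). -/
def contRep (f : ℝ → ℂ) : ℝ → ℂ :=
  if H : ∃ u : ℝ → ℂ, Continuous u ∧ f =ᵐ[volume] u then H.choose else 0

/-- The projection `π_h` onto the grid: evaluation of the continuous representative. -/
def gridProj (h : ℝ) (f : ℝ → ℂ) : Grid h → ℂ := fun a => contRep f a

/-- The discrete oscillator `H_h`; it vanishes outside `A_h = hℤ ∩ [-1/h, 1/h]`. -/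
def discreteOscillator (h : ℝ) (u : Grid h → ℂ) : Grid h → ℂ := fun a =>
  if |(a : ℝ)| ≤ 1 / h then
    -(1 / h ^ 2 * √((1 + a * h + h ^ 2) * (1 - a * h)) : ℝ) * u (a + step h)
      - (1 / h ^ 2 * √((1 - a * h + h ^ 2) * (1 + a * h)) : ℝ) * u (a - step h)
      + (1 + 2 / h ^ 2 : ℝ) * u a
  else 0

/-! ### Kravchuk and Hermite functions -/

/-- The scaled Kravchuk polynomials
`k_{n+1,h}(x) = 2x k_{n,h}(x) - 2n (1 - h² (n-1)/2) k_{n-1,h}(x)`, `k_{0,h} = 1`. -/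
def kravchukPoly (h : ℝ) : ℕ → ℝ → ℝ
  | 0, _ => 1
  | 1, x => 2 * x
  | n + 2, x => 2 * x * kravchukPoly h (n + 1) x
      - 2 * (n + 1) * (1 - h ^ 2 * (n / 2)) * kravchukPoly h n x

/-- The rescaled binomial weight `ρ_h`; it vanishes outside `A_h`. -/
def rho (h : ℝ) (a : Grid h) : ℝ :=
  if |(a : ℝ)| ≤ 1 / h then
    1 / (h * 2 ^ (2 / h ^ 2)) *
      (Real.Gamma (1 + 2 / h ^ 2) /
        (Real.Gamma (1 + 1 / h ^ 2 + a / h) * Real.Gamma (1 + 1 / h ^ 2 - a / h)))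
  else 0

/-- The normalization constants `α_{n,h}`. -/
def alpha (n : ℕ) (h : ℝ) : ℝ :=
  1 / (h ^ n * √(n.factorial)) *
    √(Real.Gamma (1 + 2 / h ^ 2 - n) / Real.Gamma (1 + 2 / h ^ 2))

/-- The Kravchuk functions `φ_{n,h}`. -/
def kravchukFun (n : ℕ) (h : ℝ) (a : Grid h) : ℝ :=
  alpha n h * kravchukPoly h n a * √(rho h a)

/-- The (physicists') Hermite polynomials `H_{n+1}(x) = 2x H_n(x) - 2n H_{n-1}(x)`, `H_0 = 1`. -/
def hermitePoly : ℕ → ℝ → ℝ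
  | 0, _ => 1
  | 1, x => 2 * x
  | n + 2, x => 2 * x * hermitePoly (n + 1) x - 2 * (n + 1) * hermitePoly n x

/-- The Hermite functions `ψ_n`. -/
def hermiteFun (n : ℕ) (x : ℝ) : ℝ :=
  1 / (Real.pi ^ (1 / 4 : ℝ) * 2 ^ (n / 2 : ℝ) * √(n.factorial)) *
    Real.exp (-x ^ 2 / 2) * hermitePoly n x

/-- The step size `h = √2 N^{-1/2}`. -/
def mesh (N : ℕ) : ℝ := √2 * (N : ℝ) ^ (-(1 / 2) : ℝ)

end Kravchuk

end

/-! Part (i) is a Taylor expansion made quantitative in `ℓ²`. The products under the square roots of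
`H_h` equal `1 + h² (1 - a²) ∓ a h³`, so the roots are `1 + h² (1 - a²) / 2 ∓ a h³ / 2` up to `O(h⁴
(1 + a²)²)` (`exists_sqrt_coeff_eq`). The consistency error at `a` then splits into the Taylor
remainder of the second difference, `(1 - a²) / 2` times the second difference, `a h / 2` times the
central first difference, and the square root remainders. Apart from the first, these cost `h²`
times local suprema of `(1 + x²)² |g|`, `(1 + x²) |g'|` and `(1 + x²) |g''|`; the Taylor remainder
costs a local integral of `|g''''|`. By the local Sobolev inequality `mul_sq_le_integral`,
everything is controlled by the integral over `[a - h, a + h]` of `∑ (1 + x²)^(5 - k) |g^(k)|²`, `k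
< 5` (`sigmaDensity`). These intervals cover the line twice, so the squares sum to a global integral
(`tsum_ofReal_le`). Outside `A_h`, where `H_h` is zero, `1 < h² a²` supplies the factor `h²`.

The `Σ⁵` norm sees only the two ends of this density: the undifferentiated function with full
weight, and the derivatives without weight. The mixed terms come from weighted interpolation:
integrating the derivative of `w^(l+1) f f'` gives a three term inequality between consecutive
weighted norms (`weighted_interpolation_step`), from which the intermediate norms are eliminated. A
bounded weight `w` makes every integral finite, and Fatou's lemma removes the regularization.

For part (ii), the ratio of a binomial coefficient to the central one is an explicit product of
factors `(1 - x) / (1 + x)`, and Wallis' product handles the central one. This gives a local limit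
theorem with relative error `O(h² (1 + a²)²)` (`abs_rho_mul_exp_sub_one_le`), hence the same for
`√ρ_h`. The normalized Kravchuk and Hermite polynomials obey the same three term recurrence up to
relative errors `O(h² n)` in the coefficients. By `three_term_bounds` their difference is at most
`h² n 2^n` times a majorant bounded by `4^n exp(x²/4)`. The ground state decays like `exp(-x²/2)`,
which leaves `exp(-x²/4)` and a loss of `16^n`. For `n` in the allowed range this loss is at most
`h^(-δ)`, because `16 ≤ e³`. -/

namespace Kravchuk

/-! ### Sums over the grid -/

/-- The grid `hℤ` is parametrized by the integers. -/
noncomputable def gridEquiv {h : ℝ} (hh : 0 < h) : ℤ ≃ Grid h :=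
  Equiv.ofBijective (fun k => ⟨k * h, AddSubgroup.mem_zmultiples_iff.2 ⟨k, by simp⟩⟩) <| by
    constructor
    · intro k l hkl
      have : (k : ℝ) * h = l * h := congrArg Subtype.val hkl
      exact_mod_cast mul_right_cancel₀ hh.ne' this
    · rintro ⟨a, ha⟩
      obtain ⟨k, hk⟩ := AddSubgroup.mem_zmultiples_iff.1 ha
      exact ⟨k, Subtype.ext (by simpa using hk)⟩

@[simp] lemma coe_gridEquiv {h : ℝ} (hh : 0 < h) (k : ℤ) : (gridEquiv hh k : ℝ) = k * h := rfl

lemma coe_step (h : ℝ) : (step h : ℝ) = h := rfl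

/-- Moves an `ℓ²` estimate to a sum over `ℤ` in `ℝ≥0∞`, where pointwise bounds can be added up with
no summability condition. -/
lemma ell2Norm_le_of_sq_le {h : ℝ} (hh : 0 < h) {u : Grid h → ℂ} {B : ℝ≥0∞}
    (hB : ∑' k : ℤ, ENNReal.ofReal (h * ‖u (gridEquiv hh k)‖ ^ 2) ≤ B ^ 2) :
    ell2Norm h u ≤ B := by
  have h1 : ENNReal.ofReal h * ∑' a : Grid h, ‖u a‖ₑ ^ 2 ≤ B ^ 2 := by
    rw [← (gridEquiv hh).tsum_eq, ← ENNReal.tsum_mul_left]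
    refine le_trans (le_of_eq (tsum_congr fun k => ?_)) hB
    rw [ENNReal.ofReal_mul hh.le, ENNReal.ofReal_pow (norm_nonneg _), ofReal_norm]
  calc ell2Norm h u ≤ (B ^ 2) ^ (1 / 2 : ℝ) := ENNReal.rpow_le_rpow h1 (by norm_num)
    _ = B := by
      rw [← ENNReal.rpow_natCast, ← ENNReal.rpow_mul]
      norm_num

/-- The intervals `((k-1)h, (k+1)h]` cover the line twice. -/
lemma tsum_lintegral_Ioc {h : ℝ} (hh : 0 < h) (F : ℝ → ℝ≥0∞) :
    ∑' k : ℤ, ∫⁻ x in Set.Ioc (k * h - h) (k * h + h), F x = 2 * ∫⁻ x, F x := by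
  have h1 : ∑' k : ℤ, ∫⁻ x in Set.Ioc (k * h) (k * h + h), F x = ∫⁻ x, F x := by
    have hu : ⋃ k : ℤ, Set.Ioc (k * h) (k * h + h) = Set.univ := by
      rw [← iUnion_Ioc_zsmul hh]
      refine Set.iUnion_congr fun k => ?_
      simp [add_mul]
    rw [← setLIntegral_univ, ← hu, lintegral_iUnion (fun k => measurableSet_Ioc)]
    have := Set.pairwise_disjoint_Ioc_zsmul h
    intro k l hkl
    simpa [Function.onFun, add_mul] using this hkl
  -- Each interval is cut at `k h`; its left half is the cell of index `k - 1`, so the sum runs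
  -- twice through the same partition.
  have h2 : ∀ k : ℤ, ∫⁻ x in Set.Ioc (k * h - h) (k * h + h), F x
      = (∫⁻ x in Set.Ioc (((k - 1 : ℤ) : ℝ) * h) (((k - 1 : ℤ) : ℝ) * h + h), F x)
        + ∫⁻ x in Set.Ioc (k * h) (k * h + h), F x := by
    intro k
    rw [← Set.Ioc_union_Ioc_eq_Ioc (b := k * h) (by linarith) (by linarith),
      lintegral_union measurableSet_Ioc]
    · rw [show ((k - 1 : ℤ) : ℝ) * h = k * h - h by push_cast; ring, sub_add_cancel]
    · rw [Set.disjoint_left]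
      intro x hx hx'
      exact absurd hx.2 (not_le.2 hx'.1)
  simp_rw [h2]
  rw [ENNReal.tsum_add, h1, two_mul]
  congr 1
  rw [← h1]
  exact (Equiv.subRight (1 : ℤ)).tsum_eq
    (fun k : ℤ => ∫⁻ x in Set.Ioc ((k : ℝ) * h) (k * h + h), F x)

/-- Local Sobolev embedding on an interval of length `2h`. -/
lemma mul_sq_le_integral {h a : ℝ} (hh : 0 < h) (h1 : h ≤ 1) {f f' : ℝ → ℝ}
    (hf : ∀ x, HasDerivAt f (f' x) x) (hf' : Continuous f') {x : ℝ}
    (hx : x ∈ Set.Icc (a - h) (a + h)) :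
    h * f x ^ 2 ≤ 2 * ∫ t in (a - h)..(a + h), (f t ^ 2 + f' t ^ 2) := by
  have hfc : Continuous f := continuous_iff_continuousAt.2 fun x => (hf x).continuousAt
  set K := ∫ t in (a - h)..(a + h), (f t ^ 2 + f' t ^ 2) with hK
  have hint : ∀ c d, IntervalIntegrable (fun t => f t ^ 2 + f' t ^ 2) volume c d :=
    fun c d => (by fun_prop : Continuous fun t => f t ^ 2 + f' t ^ 2).intervalIntegrable _ _
  have key : ∀ y ∈ Set.Icc (a - h) (a + h), f x ^ 2 - f y ^ 2 ≤ K := by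
    intro y hy
    have hd : ∀ t ∈ Set.uIcc y x, HasDerivAt (fun t => f t ^ 2) (2 * f t * f' t) t := by
      intro t _
      simpa using (hf t).fun_pow 2
    have e1 := intervalIntegral.integral_eq_sub_of_hasDerivAt hd
      ((by fun_prop : Continuous fun t => 2 * f t * f' t).intervalIntegrable _ _)
    rw [← e1]
    refine (le_abs_self _).trans ?_
    rw [← Real.norm_eq_abs]
    refine (intervalIntegral.norm_integral_le_integral_norm_uIoc).trans ?_
    rw [hK, intervalIntegral.integral_of_le (by linarith)]
    have hsub : Set.uIoc y x ⊆ Set.Ioc (a - h) (a + h) := by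
      intro t ht
      rw [Set.mem_uIoc] at ht
      constructor <;> rcases ht with ht | ht <;> linarith [hx.1, hx.2, hy.1, hy.2, ht.1, ht.2]
    have hi : IntegrableOn (fun t => f t ^ 2 + f' t ^ 2) (Set.Ioc (a - h) (a + h)) :=
      (hint (a - h) (a + h)).1
    calc ∫ t in Set.uIoc y x, ‖2 * f t * f' t‖
        ≤ ∫ t in Set.uIoc y x, (f t ^ 2 + f' t ^ 2) := by
          refine integral_mono_of_nonneg (ae_of_all _ fun t => norm_nonneg _)
            (hi.mono_set hsub) (ae_of_all _ fun t => ?_)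
          simp only [Real.norm_eq_abs]
          rw [abs_le]
          constructor <;> nlinarith [sq_nonneg (f t + f' t), sq_nonneg (f t - f' t)]
      _ ≤ _ := setIntegral_mono_set hi (ae_of_all _ fun t => by positivity)
          (ae_of_all _ hsub)
  -- Averaging `key` over `y` in an interval of length `2h` gives `2h (f x² - K) ≤ K`; with `h ≤ 1`
  -- this is `2h f x² ≤ 3K`.
  have e2 : ∫ y in (a - h)..(a + h), (f x ^ 2 - K) ≤ ∫ y in (a - h)..(a + h), f y ^ 2 := by
    refine intervalIntegral.integral_mono_on (by linarith) (by simp)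
      ((by fun_prop : Continuous fun t => f t ^ 2).intervalIntegrable _ _) fun y hy => ?_
    linarith [key y hy]
  have e3 : ∫ y in (a - h)..(a + h), f y ^ 2 ≤ K := by
    refine intervalIntegral.integral_mono_on (by linarith)
      ((by fun_prop : Continuous fun t => f t ^ 2).intervalIntegrable _ _) (hint _ _)
      fun y hy => ?_
    linarith [sq_nonneg (f' y)]
  have hK0 : 0 ≤ K := intervalIntegral.integral_nonneg (by linarith) fun t _ => by positivity
  simp only [intervalIntegral.integral_const, smul_eq_mul] at e2
  nlinarith

/-- Pointwise bounds by local integrals sum up to a bound by a global integral. -/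
lemma tsum_ofReal_le {h : ℝ} (hh : 0 < h) {S : ℤ → ℝ} {Φ : ℝ → ℝ} (hΦ : Continuous Φ)
    (hΦ0 : ∀ x, 0 ≤ Φ x) {C : ℝ} (hC : 0 ≤ C)
    (hS : ∀ k : ℤ, S k ≤ C * ∫ t in (k * h - h)..(k * h + h), Φ t) :
    ∑' k : ℤ, ENNReal.ofReal (S k)
      ≤ ENNReal.ofReal (2 * C) * ∫⁻ x, ENNReal.ofReal (Φ x) := by
  calc ∑' k : ℤ, ENNReal.ofReal (S k)
      ≤ ∑' k : ℤ, ENNReal.ofReal C *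
          ∫⁻ x in Set.Ioc (k * h - h) (k * h + h), ENNReal.ofReal (Φ x) := by
        refine ENNReal.tsum_le_tsum fun k => ?_
        refine (ENNReal.ofReal_le_ofReal (hS k)).trans ?_
        rw [ENNReal.ofReal_mul hC, intervalIntegral.integral_of_le (by linarith),
          ofReal_integral_eq_lintegral_ofReal _ (ae_of_all _ hΦ0)]
        exact (hΦ.intervalIntegrable (k * h - h) (k * h + h)).1
    _ = _ := by
        rw [ENNReal.tsum_mul_left, tsum_lintegral_Ioc hh, ← mul_assoc,
          ENNReal.ofReal_mul (by norm_num), mul_comm (ENNReal.ofReal 2)]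
        simp

end Kravchuk

namespace Kravchuk

/-! ### The binomial weight -/

/-- The ratio `binom(2M, M + k) / binom(2M, M)`. -/
noncomputable def binomRatio (M k : ℕ) : ℝ := ∏ j ∈ Finset.range k, ((M : ℝ) - j) / (M + j + 1)

lemma binomRatio_succ (M k : ℕ) :
    binomRatio M (k + 1) = binomRatio M k * (((M : ℝ) - k) / (M + k + 1)) :=
  Finset.prod_range_succ _ _

lemma binomRatio_nonneg {M k : ℕ} (hk : k ≤ M) : 0 ≤ binomRatio M k := by
  refine Finset.prod_nonneg fun j hj => ?_
  have hj' : (j : ℝ) ≤ M := by exact_mod_cast ((Finset.mem_range.1 hj).le.trans hk)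
  exact div_nonneg (by linarith) (by positivity)

/-- Raising `k` by one moves a factor from one Gamma value to the other by the functional equation,
and `binomRatio` compensates. The bound `k ≤ M` keeps all arguments positive. -/
lemma Gamma_mul_Gamma_mul_binomRatio {M k : ℕ} (hk : k ≤ M) :
    Real.Gamma (1 + M + k) * Real.Gamma (1 + M - k) * binomRatio M k
      = Real.Gamma (1 + M) ^ 2 := by
  induction k with
  | zero => simp [binomRatio]; ring
  | succ k ih =>
    have hkM : (k : ℝ) + 1 ≤ M := by exact_mod_cast hk
    rw [← ih (by omega), binomRatio_succ]
    have e1 : Real.Gamma (1 + M + (k + 1 : ℕ)) = (1 + M + k) * Real.Gamma (1 + M + k) := by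
      rw [← Real.Gamma_add_one (by positivity)]
      congr 1
      push_cast
      ring
    have e2 : Real.Gamma (1 + M - k) = (M - k) * Real.Gamma (1 + M - (k + 1 : ℕ)) := by
      rw [show (1 + (M : ℝ) - (k + 1 : ℕ)) = M - k by push_cast; ring,
        ← Real.Gamma_add_one (by linarith)]
      congr 1
      ring
    rw [e1, e2]
    have : (M : ℝ) + k + 1 ≠ 0 := by positivity
    field_simp
    ring

/-- The series of `log (1 + x) - log (1 - x)` has nonnegative terms and begins with `2x`. The
endpoint `x = 1`, outside the range of the series, is trivial. -/
lemma one_sub_mul_exp_le {x : ℝ} (hx0 : 0 ≤ x) (hx1 : x ≤ 1) :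
    1 - x ≤ (1 + x) * Real.exp (-(2 * x)) := by
  rcases hx1.eq_or_lt with rfl | hx1
  · have := Real.exp_pos (-(2 * 1)); linarith
  have hs := Real.hasSum_log_sub_log_of_abs_lt_one (x := x) (by rwa [abs_of_nonneg hx0])
  have h2 : 2 * x ≤ Real.log (1 + x) - Real.log (1 - x) := by
    have := hs.summable.sum_le_tsum (Finset.range 1) (fun i _ => by positivity)
    rw [hs.tsum_eq] at this
    simpa using this
  have h3 : Real.log (1 - x) ≤ Real.log (1 + x) - 2 * x := by linarith
  calc 1 - x = Real.exp (Real.log (1 - x)) := (Real.exp_log (by linarith)).symm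
    _ ≤ Real.exp (Real.log (1 + x) - 2 * x) := Real.exp_le_exp.2 h3
    _ = (1 + x) * Real.exp (-(2 * x)) := by
      rw [sub_eq_add_neg, Real.exp_add, Real.exp_log (by linarith)]

/-- The quadratic lower bound of the exponential suffices for `x ≤ 1/2`. The cubic coefficient is
not sharp; `4` is convenient because `4 ∑ j³ ≤ k⁴` over `j < k`. -/
lemma one_add_mul_exp_le {x : ℝ} (hx0 : 0 ≤ x) (hx1 : x ≤ 1 / 2) :
    (1 + x) * Real.exp (-(2 * x + 4 * x ^ 3)) ≤ 1 - x := by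
  have h1 : 1 + x ≤ (1 - x) * Real.exp (2 * x + 4 * x ^ 3) := by
    have h2 := Real.quadratic_le_exp_of_nonneg (x := 2 * x + 4 * x ^ 3) (by positivity)
    refine le_trans ?_ (mul_le_mul_of_nonneg_left h2 (by linarith))
    have h3 : 0 ≤ x ^ 3 := by positivity
    have h4 : 0 ≤ x ^ 5 := by positivity
    nlinarith [mul_nonneg h3 (sub_nonneg.2 hx1), mul_nonneg h4 (sub_nonneg.2 hx1),
      mul_nonneg (mul_nonneg h3 hx0) (sub_nonneg.2 hx1),
      mul_nonneg (mul_nonneg h4 hx0) (sub_nonneg.2 hx1)]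
  rw [Real.exp_neg]
  have := Real.exp_pos (2 * x + 4 * x ^ 3)
  rw [← div_eq_mul_inv, div_le_iff₀ this]
  exact h1

/-- The factor `1 + k / M` turns the product into exactly `∏ (1 - x_j) / (1 + x_j)` with `x_j = j /
M`, `j < k`. Each factor is at most `exp(-2 x_j)`, and the exponents add up to `-k (k - 1) / M`. -/
lemma binomRatio_mul_le {M k : ℕ} (hM : 0 < M) (hk : k ≤ M) :
    binomRatio M k * (1 + k / M) ≤ Real.exp (-(k * (k - 1) / M)) := by
  have hM' : (0 : ℝ) < M := by exact_mod_cast hM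
  induction k with
  | zero => simp [binomRatio]
  | succ k ih =>
    have hkM : (k : ℝ) + 1 ≤ M := by exact_mod_cast hk
    have ih := ih (by omega)
    set x : ℝ := k / M with hx
    have hxM : (k : ℝ) = x * M := by rw [hx]; field_simp
    have hx0 : 0 ≤ x := by positivity
    have hx1 : x ≤ 1 := by rw [hx, div_le_one hM']; linarith
    have e1 : binomRatio M (k + 1) * (1 + (k + 1 : ℕ) / M)
        = binomRatio M k * (1 + x) * ((1 - x) / (1 + x)) := by
      rw [binomRatio_succ]
      push_cast
      rw [hxM]
      have : x * M + M + 1 ≠ 0 := by positivity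
      have : x + 1 ≠ 0 := by positivity
      field_simp
      ring
    have e2 : (1 - x) / (1 + x) ≤ Real.exp (-(2 * x)) := by
      rw [div_le_iff₀ (by positivity), mul_comm]
      exact one_sub_mul_exp_le hx0 hx1
    rw [e1]
    calc binomRatio M k * (1 + x) * ((1 - x) / (1 + x))
        ≤ Real.exp (-(k * (k - 1) / M)) * Real.exp (-(2 * x)) :=
          mul_le_mul ih e2 (div_nonneg (by linarith) (by linarith)) (Real.exp_pos _).le
      _ = _ := by
          rw [← Real.exp_add]
          congr 1
          push_cast
          rw [hxM]
          field_simp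
          ring

/-- The same product, now with the cubic correction in each factor; `2 * k ≤ M` ensures that every
`x_j` is at most `1/2`. -/
lemma le_binomRatio_mul {M k : ℕ} (hM : 0 < M) (hk : 2 * k ≤ M) :
    Real.exp (-(k * (k - 1) / M + k ^ 4 / M ^ 3)) ≤ binomRatio M k * (1 + k / M) := by
  have hM' : (0 : ℝ) < M := by exact_mod_cast hM
  induction k with
  | zero => simp [binomRatio]
  | succ k ih =>
    have hkM : 2 * ((k : ℝ) + 1) ≤ M := by exact_mod_cast hk
    have ih := ih (by omega)
    set x : ℝ := k / M with hx
    have hxM : (k : ℝ) = x * M := by rw [hx]; field_simp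
    have hx0 : 0 ≤ x := by positivity
    have hx1 : x ≤ 1 / 2 := by rw [hx, div_le_iff₀ hM']; linarith
    have e1 : binomRatio M (k + 1) * (1 + (k + 1 : ℕ) / M)
        = binomRatio M k * (1 + x) * ((1 - x) / (1 + x)) := by
      rw [binomRatio_succ]
      push_cast
      rw [hxM]
      have : x * M + M + 1 ≠ 0 := by positivity
      have : x + 1 ≠ 0 := by positivity
      field_simp
      ring
    have e2 : Real.exp (-(2 * x + 4 * x ^ 3)) ≤ (1 - x) / (1 + x) := by
      rw [le_div_iff₀ (by positivity), mul_comm]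
      exact one_add_mul_exp_le hx0 hx1
    rw [e1]
    calc Real.exp (-((k + 1 : ℕ) * ((k + 1 : ℕ) - 1) / M + (k + 1 : ℕ) ^ 4 / M ^ 3))
        ≤ Real.exp (-(k * (k - 1) / M + k ^ 4 / M ^ 3)) * Real.exp (-(2 * x + 4 * x ^ 3)) := by
          rw [← Real.exp_add, Real.exp_le_exp]
          have e3 : ((k + 1 : ℕ) : ℝ) * ((k + 1 : ℕ) - 1) / M = k * (k - 1) / M + 2 * x := by
            push_cast
            rw [hx]
            field_simp
            ring
          have e4 : (k : ℝ) ^ 4 / M ^ 3 + 4 * x ^ 3 ≤ ((k + 1 : ℕ) : ℝ) ^ 4 / M ^ 3 := by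
            rw [hx, div_pow, mul_div_assoc', ← add_div]
            refine div_le_div_of_nonneg_right ?_ (by positivity)
            push_cast
            have : (0 : ℝ) ≤ k := by positivity
            nlinarith [sq_nonneg (k : ℝ)]
          linarith
      _ ≤ _ := mul_le_mul ih e2 (Real.exp_pos _).le ((Real.exp_pos _).le.trans ih)

/-- Gaussian asymptotics of the ratio of binomial coefficients. -/
lemma abs_binomRatio_mul_exp_sub_one_le {M k : ℕ} (hM : 0 < M) (hk : k ≤ M) :
    |binomRatio M k * Real.exp (k ^ 2 / M) - 1| ≤ k ^ 4 / M ^ 3 + 4 * (k ^ 2 / M ^ 2) := by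
  have hM' : (0 : ℝ) < M := by exact_mod_cast hM
  have hkM : (k : ℝ) ≤ M := by exact_mod_cast hk
  set y : ℝ := k / M with hy
  have hy0 : 0 ≤ y := by positivity
  have hy1 : y ≤ 1 := by rw [hy, div_le_one hM']; exact hkM
  have hr := binomRatio_nonneg hk
  have hexp : ∀ z : ℝ, Real.exp (-(k * (k - 1) / M + z)) * Real.exp (k ^ 2 / M)
      = Real.exp y * Real.exp (-z) := by
    intro z
    rw [← Real.exp_add, ← Real.exp_add]
    congr 1
    rw [hy]
    field_simp
    ring
  have hyexp : Real.exp y ≤ 1 + y + y ^ 2 := by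
    have := Real.abs_exp_sub_one_sub_id_le (x := y) (by rwa [abs_of_nonneg hy0])
    linarith [(abs_le.1 this).2]
  have hsq : (k : ℝ) ^ 2 / M ^ 2 = y ^ 2 := by rw [hy, div_pow]
  rw [abs_le]
  constructor
  -- For `2k > M` the lower bound is void: `4 y² ≥ 1`, while the quantity to be bounded is at least
  -- `-1`.
  · by_cases hk2 : 2 * k ≤ M
    · have h1 := mul_le_mul_of_nonneg_right (le_binomRatio_mul hM hk2)
        (Real.exp_pos ((k : ℝ) ^ 2 / M)).le
      rw [hexp] at h1
      have h2 : (1 + y) * Real.exp (-((k : ℝ) ^ 4 / M ^ 3))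
          ≤ binomRatio M k * Real.exp (k ^ 2 / M) * (1 + y) := by
        refine le_trans (mul_le_mul_of_nonneg_right ?_ (Real.exp_pos _).le)
          (h1.trans (le_of_eq (by ring)))
        linarith [Real.add_one_le_exp y]
      have h3 : Real.exp (-((k : ℝ) ^ 4 / M ^ 3)) ≤ binomRatio M k * Real.exp (k ^ 2 / M) := by
        rw [mul_comm] at h2
        exact le_of_mul_le_mul_right h2 (by positivity)
      have h4 := Real.add_one_le_exp (-((k : ℝ) ^ 4 / M ^ 3))
      have : 0 ≤ (k : ℝ) ^ 2 / M ^ 2 := by positivity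
      linarith
    · have h1 : 1 / 2 ≤ y := by
        rw [hy, le_div_iff₀ hM']
        have : (M : ℝ) ≤ 2 * k := by exact_mod_cast (by omega : M ≤ 2 * k)
        linarith
      have h2 : 0 ≤ (k : ℝ) ^ 4 / M ^ 3 := by positivity
      have h3 : 0 ≤ binomRatio M k * Real.exp (k ^ 2 / M) := by positivity
      rw [hsq]
      nlinarith
  -- The linear part of the exponent produces `exp y`, which the prefactor `1 + y` cancels to first
  -- order: `exp y ≤ 1 + y + y² ≤ (1 + y²) (1 + y)`.
  · have h1 := mul_le_mul_of_nonneg_right (binomRatio_mul_le hM hk)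
      (Real.exp_pos ((k : ℝ) ^ 2 / M)).le
    have h0 := hexp 0
    rw [add_zero, neg_zero, Real.exp_zero, mul_one] at h0
    rw [h0] at h1
    have h2 : binomRatio M k * Real.exp (k ^ 2 / M) * (1 + y) ≤ (1 + y ^ 2) * (1 + y) := by
      have : 0 ≤ y ^ 3 := by positivity
      nlinarith
    have h3 := le_of_mul_le_mul_right h2 (by positivity)
    have h4 : 0 ≤ (k : ℝ) ^ 4 / M ^ 3 := by positivity
    rw [hsq]
    nlinarith [sq_nonneg y]

/-- The normalized central binomial coefficient `√(πM) binom(2M, M) / 4^M`. -/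
noncomputable def centralRatio (M : ℕ) : ℝ :=
  √Real.pi * (√M * ((2 * M).factorial / (4 ^ M * (M.factorial : ℝ) ^ 2)))

lemma centralRatio_sq (M : ℕ) :
    centralRatio M ^ 2 = Real.pi * M / ((2 * M + 1) * Real.Wallis.W M) := by
  rw [Real.Wallis.W_eq_factorial_ratio, centralRatio, mul_pow, mul_pow,
    Real.sq_sqrt Real.pi_pos.le, Real.sq_sqrt (by positivity)]
  have h1 : (M.factorial : ℝ) ≠ 0 := by positivity
  have h2 : ((2 * M).factorial : ℝ) ≠ 0 := by positivity
  have h3 : (4 : ℝ) ^ M = 2 ^ (2 * M) := by rw [pow_mul]; norm_num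
  rw [h3, show 4 * M = 2 * M + 2 * M by ring, pow_add]
  field_simp

/-- The Wallis product lies between `(2M + 1) / (2M + 2) · π / 2` and `π / 2`, which places the
square between `1 - 1 / M` and `1`. As the ratio itself is in `[0, 1]`, it dominates its square and
inherits the lower bound. -/
lemma centralRatio_mem {M : ℕ} (hM : 0 < M) :
    1 - 1 / M ≤ centralRatio M ∧ centralRatio M ≤ 1 := by
  have hM' : (0 : ℝ) < M := by exact_mod_cast hM
  have hW := Real.Wallis.W_pos M
  have h0 : 0 ≤ centralRatio M := by unfold centralRatio; positivity
  have hup : centralRatio M ^ 2 ≤ 1 := by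
    rw [centralRatio_sq, div_le_one (by positivity)]
    have h1 := Real.Wallis.le_W M
    have h2 : (2 * (M : ℝ) + 1) * ((2 * M + 1) / (2 * M + 2) * (Real.pi / 2))
        ≤ (2 * M + 1) * Real.Wallis.W M := mul_le_mul_of_nonneg_left h1 (by positivity)
    refine le_trans ?_ h2
    have h3 : (M : ℝ) ≤ (2 * M + 1) * ((2 * M + 1) / (2 * M + 2)) / 2 := by
      rw [mul_div_assoc', div_div, le_div_iff₀ (by positivity)]
      nlinarith
    nlinarith [Real.pi_pos]
  have hlow : 1 - 1 / M ≤ centralRatio M ^ 2 := by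
    rw [centralRatio_sq, le_div_iff₀ (by positivity)]
    by_cases h1 : (1 : ℝ) - 1 / M < 0
    · have : 0 ≤ (2 * (M : ℝ) + 1) * Real.Wallis.W M := by positivity
      have := Real.pi_pos
      nlinarith [mul_pos Real.pi_pos hM']
    have h2 := mul_le_mul_of_nonneg_left
      (mul_le_mul_of_nonneg_left (Real.Wallis.W_le M) (by positivity : (0 : ℝ) ≤ 2 * M + 1))
      (not_lt.1 h1)
    refine h2.trans ?_
    have h3 : (1 - 1 / (M : ℝ)) * (2 * M + 1) ≤ 2 * M := by
      have : (1 - 1 / (M : ℝ)) * (2 * M + 1) = 2 * M - 1 - 1 / M := by field_simp; ring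
      rw [this]
      have : 0 ≤ 1 / (M : ℝ) := by positivity
      linarith
    nlinarith [Real.pi_pos]
  have hle : centralRatio M ≤ 1 := by nlinarith
  exact ⟨by nlinarith, hle⟩

lemma mesh_two_mul_sq {M : ℕ} : mesh (2 * M) ^ 2 = 1 / M := by
  unfold mesh
  rw [mul_pow, Real.sq_sqrt (by norm_num), ← Real.rpow_natCast, ← Real.rpow_mul (by positivity)]
  norm_num
  rw [Real.rpow_neg_one]
  rw [mul_inv]
  ring

lemma mesh_pos {N : ℕ} (hN : 0 < N) : 0 < mesh N := by
  unfold mesh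
  positivity

/-! ### Gaussian asymptotics of the weight on the grid -/

section weight

variable {M : ℕ} {h : ℝ}

lemma rho_neg (a : Grid h) : rho h (-a) = rho h a := by
  unfold rho
  simp only [NegMemClass.coe_neg, abs_neg, neg_div, sub_neg_eq_add, ← sub_eq_add_neg]
  rw [mul_comm (Real.Gamma _)]

/-- With `h² = 1 / M` the Gamma arguments become `1 + 2M` and `1 + M ± k`. The factor `1 / h = √M`
goes into `centralRatio`, and all dependence on `k` into `binomRatio`. -/
lemma rho_eq_of_le (hM : 0 < M) (hh : 0 < h) (hM2 : h ^ 2 = 1 / M) {a : Grid h} {k : ℕ}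
    (ha : (a : ℝ) = k * h) (hk : k ≤ M) :
    √Real.pi * rho h a = centralRatio M * binomRatio M k := by
  have hM' : (0 : ℝ) < M := by exact_mod_cast hM
  have hkM : (k : ℝ) ≤ M := by exact_mod_cast hk
  have h1 : 1 / h ^ 2 = M := by rw [hM2]; simp
  have h2 : 2 / h ^ 2 = ((2 * M : ℕ) : ℝ) := by rw [hM2]; push_cast; field_simp
  have h3 : 1 / h = √M := by
    rw [← h1, Real.sqrt_div' _ (by positivity), Real.sqrt_one, Real.sqrt_sq hh.le]
  have h4 : (a : ℝ) / h = k := by rw [ha]; field_simp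
  have hle : |(a : ℝ)| ≤ 1 / h := by
    rw [ha, abs_of_nonneg (by positivity), le_div_iff₀ hh, mul_assoc, ← sq, hM2,
      mul_one_div, div_le_one hM']
    exact hkM
  have hG := Gamma_mul_Gamma_mul_binomRatio hk
  have g1 : 0 < Real.Gamma (1 + M + k) := Real.Gamma_pos_of_pos (by positivity)
  have g2 : 0 < Real.Gamma (1 + M - k) := Real.Gamma_pos_of_pos (by linarith)
  unfold rho
  rw [if_pos hle, h1, h2, h4, Real.rpow_natCast, centralRatio, ← one_div_mul_one_div, h3]
  rw [add_comm 1 (M : ℝ), Real.Gamma_nat_eq_factorial, ← add_comm 1 (M : ℝ)] at hG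
  rw [add_comm 1 ((2 * M : ℕ) : ℝ), Real.Gamma_nat_eq_factorial, pow_mul]
  have hf : (M.factorial : ℝ) ≠ 0 := by positivity
  rw [← hG]
  have hb : binomRatio M k ≠ 0 := by
    intro h0
    rw [h0, mul_zero] at hG
    exact hf (by simpa using hG.symm)
  norm_num
  field_simp

/-- Local central limit theorem: `ρ_h` is a Gaussian up to a relative error `O(h²)`. -/
lemma abs_rho_mul_exp_sub_one_le (hM : 0 < M) (hh : 0 < h) (hM2 : h ^ 2 = 1 / M) (a : Grid h) :
    |√Real.pi * rho h a * Real.exp ((a : ℝ) ^ 2) - 1| ≤ 2 * h ^ 2 * (1 + (a : ℝ) ^ 2) ^ 2 := by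
  have hM' : (0 : ℝ) < M := by exact_mod_cast hM
  obtain ⟨z, rfl⟩ := (gridEquiv hh).surjective a
  wlog hz : 0 ≤ z generalizing z
  · have := this (-z) (by omega)
    have e : gridEquiv hh (-z) = -gridEquiv hh z := Subtype.ext (by simp)
    rw [e, rho_neg] at this
    simpa using this
  obtain ⟨k, rfl⟩ := Int.eq_ofNat_of_zero_le hz
  set a := gridEquiv hh (k : ℤ) with ha
  have hak : (a : ℝ) = k * h := by simp [ha]
  by_cases hk : k ≤ M
  · rw [rho_eq_of_le hM hh hM2 hak hk]
    have hX := abs_binomRatio_mul_exp_sub_one_le hM hk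
    obtain ⟨hY1, hY2⟩ := centralRatio_mem hM
    have hY0 : 0 ≤ centralRatio M := by unfold centralRatio; positivity
    have e1 : (a : ℝ) ^ 2 = k ^ 2 / M := by rw [hak, mul_pow, hM2]; ring
    have e2 : (k : ℝ) ^ 4 / M ^ 3 = h ^ 2 * ((a : ℝ) ^ 2) ^ 2 := by
      rw [e1, hM2]; field_simp
    have e3 : (k : ℝ) ^ 2 / M ^ 2 = h ^ 2 * (a : ℝ) ^ 2 := by
      rw [e1, hM2]; field_simp
    rw [e2, e3, ← e1] at hX
    rw [← hM2] at hY1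
    set X := binomRatio M k * Real.exp ((a : ℝ) ^ 2) with hXdef
    have e4 : centralRatio M * binomRatio M k * Real.exp ((a : ℝ) ^ 2) - 1
        = centralRatio M * (X - 1) + (centralRatio M - 1) := by rw [hXdef]; ring
    rw [e4]
    calc |centralRatio M * (X - 1) + (centralRatio M - 1)|
        ≤ |centralRatio M * (X - 1)| + |centralRatio M - 1| := abs_add_le _ _
      _ ≤ 1 * (h ^ 2 * ((a : ℝ) ^ 2) ^ 2 + 4 * (h ^ 2 * (a : ℝ) ^ 2)) + h ^ 2 := by
          rw [abs_mul, abs_of_nonneg hY0]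
          refine add_le_add (mul_le_mul hY2 hX (abs_nonneg _) zero_le_one) ?_
          rw [abs_le]
          constructor <;> nlinarith [sq_nonneg h]
      _ ≤ _ := by nlinarith [sq_nonneg h, mul_nonneg (sq_nonneg h) (sq_nonneg ((a : ℝ) ^ 2))]
  -- Outside `A_h` the weight is zero and the error is exactly `1`, which is less than `h² a² = (k
  -- h²)²`.
  · have hkM : (M : ℝ) < k := by exact_mod_cast not_le.1 hk
    have e0 : (1 : ℝ) < k * h ^ 2 := by
      rw [hM2, mul_one_div, one_lt_div hM']; exact hkM
    have hlt : ¬ |(a : ℝ)| ≤ 1 / h := by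
      rw [not_le, hak, abs_of_nonneg (by positivity), div_lt_iff₀ hh]
      nlinarith
    have hrho : rho h a = 0 := if_neg hlt
    rw [hrho]
    have : (1 : ℝ) ≤ h ^ 2 * (a : ℝ) ^ 2 := by
      rw [hak]
      nlinarith
    simp only [mul_zero, zero_mul, zero_sub, abs_neg, abs_one]
    nlinarith [mul_nonneg (sq_nonneg h) (sq_nonneg ((a : ℝ) ^ 2)), sq_nonneg h]

end weight

end Kravchuk

namespace Kravchuk

/-! ### Bounds for the normalized polynomials -/

/-- A majorant of the normalized Hermite polynomials at `±s`. -/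
noncomputable def majorant (s : ℝ) (n : ℕ) : ℝ :=
  ∏ j ∈ Finset.range n, (1 + √(2 / (j + 1)) * s)

lemma majorant_succ (s : ℝ) (n : ℕ) :
    majorant s (n + 1) = majorant s n * (1 + √(2 / (n + 1)) * s) :=
  Finset.prod_range_succ _ _

lemma majorant_pos {s : ℝ} (hs : 0 ≤ s) (n : ℕ) : 0 < majorant s n :=
  Finset.prod_pos fun _ _ => by positivity

lemma majorant_le_succ {s : ℝ} (hs : 0 ≤ s) (n : ℕ) : majorant s n ≤ majorant s (n + 1) := by
  rw [majorant_succ]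
  refine le_mul_of_one_le_right (majorant_pos hs n).le ?_
  have : 0 ≤ √(2 / ((n : ℝ) + 1)) * s := by positivity
  linarith

/-- If `z ≤ n + 1`, the last factor is at most `2` and induction applies. Otherwise every factor is
at most `2z / (j + 1)`, and the whole product is at most `2^(n+1)` times a term of the series of
`exp z`. -/
lemma prod_one_add_div_le {z : ℝ} (hz : 0 ≤ z) (n : ℕ) :
    ∏ j ∈ Finset.range n, (1 + z / ((j : ℝ) + 1)) ≤ 2 ^ n * Real.exp z := by
  induction n with
  | zero => simpa using hz
  | succ n ih =>
    by_cases hzn : z ≤ n + 1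
    · rw [Finset.prod_range_succ, pow_succ]
      have h1 : 1 + z / ((n : ℝ) + 1) ≤ 2 := by
        have : z / ((n : ℝ) + 1) ≤ 1 := by rw [div_le_one (by positivity)]; exact hzn
        linarith
      calc _ ≤ 2 ^ n * Real.exp z * 2 := mul_le_mul ih h1 (by positivity) (by positivity)
        _ = _ := by ring
    · rw [not_le] at hzn
      have h1 : ∏ j ∈ Finset.range (n + 1), (1 + z / ((j : ℝ) + 1))
          ≤ ∏ j ∈ Finset.range (n + 1), (2 * z / ((j : ℝ) + 1)) := by
        refine Finset.prod_le_prod (fun j _ => by positivity) fun j hj => ?_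
        have hj' : (j : ℝ) ≤ n := by
          exact_mod_cast Nat.lt_succ_iff.1 (Finset.mem_range.1 hj)
        have : 1 ≤ z / ((j : ℝ) + 1) := by rw [one_le_div (by positivity)]; linarith
        have e : 2 * z / ((j : ℝ) + 1) = 2 * (z / (j + 1)) := by ring
        linarith
      refine h1.trans ?_
      rw [Finset.prod_div_distrib, Finset.prod_const, Finset.card_range, mul_pow]
      have e : ∏ j ∈ Finset.range (n + 1), ((j : ℝ) + 1) = (n + 1).factorial := by
        rw [← Finset.prod_range_add_one_eq_factorial]
        push_cast
        rfl
      rw [e, mul_div_assoc]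
      exact mul_le_mul_of_nonneg_left (Real.pow_div_factorial_le_exp _ hz _) (by positivity)

/-- Squaring and `(1 + t)² ≤ 5 (1 + t² / 4)` reduce to `prod_one_add_div_le` with `z = s² / 2`, and
`5 · 2 ≤ 4²`. The point is the exponent: `s² / 4` is beaten by the decay `exp(-s² / 2)` of the
ground state. -/
lemma majorant_le {s : ℝ} (hs : 0 ≤ s) (n : ℕ) : majorant s n ≤ 4 ^ n * Real.exp (s ^ 2 / 4) := by
  have h1 : majorant s n ^ 2 ≤ 5 ^ n * (2 ^ n * Real.exp (s ^ 2 / 2)) := by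
    refine le_trans ?_ (mul_le_mul_of_nonneg_left
      (prod_one_add_div_le (z := s ^ 2 / 2) (by positivity) n) (by positivity))
    unfold majorant
    rw [← Finset.prod_pow, ← Finset.card_range n, ← Finset.prod_const, Finset.card_range,
      ← Finset.prod_mul_distrib]
    refine Finset.prod_le_prod (fun j _ => by positivity) fun j _ => ?_
    have e : (√(2 / ((j : ℝ) + 1)) * s) ^ 2 = 4 * (s ^ 2 / 2 / (j + 1)) := by
      rw [mul_pow, Real.sq_sqrt (by positivity)]
      field_simp
      ring
    nlinarith [sq_nonneg (√(2 / ((j : ℝ) + 1)) * s / 2 - 2)]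
  refine le_of_sq_le_sq (h1.trans ?_) (by positivity)
  rw [mul_pow, ← Real.exp_nat_mul, ← mul_assoc, ← mul_pow, ← pow_mul, mul_comm n 2, pow_mul]
  refine mul_le_mul (pow_le_pow_left₀ (by norm_num) (by norm_num) n) (le_of_eq ?_)
    (Real.exp_pos _).le (by positivity)
  congr 1
  push_cast
  ring

/-- Stability of the three term recurrence of the Hermite functions. -/
lemma three_term_bounds {x κ : ℝ} (hκ : 0 ≤ κ) {L : ℕ} {p q ε ε' ζ : ℕ → ℝ} (hκL : κ * L ≤ 1)
    (hp0 : p 0 = 1) (hq0 : q 0 = 1) (hp1 : p 1 = √2 * x) (hq1 : q 1 = √2 * x)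
    (hζ0 : ∀ n, 0 ≤ ζ n) (hζ1 : ∀ n, ζ n ≤ 1)
    (hε : ∀ n, n + 2 ≤ L → |ε n| ≤ κ * (n + 1)) (hε' : ∀ n, n + 2 ≤ L → |ε' n| ≤ κ * (n + 1))
    (hq : ∀ n, q (n + 2) = √(2 / ((n + 1 : ℕ) + 1)) * x * q (n + 1) - ζ n * q n)
    (hp : ∀ n, n + 2 ≤ L → p (n + 2)
      = (1 + ε n) * (√(2 / ((n + 1 : ℕ) + 1)) * x * p (n + 1)) - (1 + ε' n) * (ζ n * p n))
    {n : ℕ} (hn : n ≤ L) :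
    |q n| ≤ majorant |x| n ∧ |p n| ≤ 2 ^ n * majorant |x| n ∧
      |p n - q n| ≤ κ * (n * 2 ^ n) * majorant |x| n := by
  have hs := abs_nonneg x
  induction n using Nat.strong_induction_on with
  | _ n ih =>
  match n, hn, ih with
  | 0, _, _ => simp [hp0, hq0, majorant]
  | 1, _, _ =>
    have hm : majorant |x| 1 = 1 + √2 * |x| := by simp [majorant]
    have h2 : |√2 * x| = √2 * |x| := by rw [abs_mul, abs_of_nonneg (Real.sqrt_nonneg _)]
    have h3 : 0 ≤ √2 * |x| := by positivity
    rw [hp1, hq1, h2, hm, sub_self, abs_zero]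
    refine ⟨by linarith, by norm_num; linarith, by positivity⟩
  | n + 2, hn, ih =>
    obtain ⟨a1, a2, a3⟩ := ih n (by omega) (by omega)
    obtain ⟨b1, b2, b3⟩ := ih (n + 1) (by omega) (by omega)
    set m0 := majorant |x| n
    set m1 := majorant |x| (n + 1)
    have hm : majorant |x| (n + 2) = m1 * (1 + √(2 / ((n + 1 : ℕ) + 1)) * |x|) :=
      majorant_succ _ _
    have hm01 : m0 ≤ m1 := majorant_le_succ hs n
    have hm0 : 0 < m0 := majorant_pos hs n
    have hm1 : 0 < m1 := majorant_pos hs (n + 1)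
    set y := √(2 / (((n + 1 : ℕ) : ℝ) + 1))
    have hy : 0 ≤ y := Real.sqrt_nonneg _
    have hys : 0 ≤ y * |x| := by positivity
    have key : ∀ A B C : ℝ, ∀ u v : ℝ, |u| ≤ A → |v| ≤ B → A ≤ C * m1 → B ≤ C * m1 →
        |y * x * u| + |ζ n * v| ≤ C * (m1 * (1 + y * |x|)) := by
      intro A B C u v hu hv hA hB
      rw [abs_mul, abs_mul, abs_mul, abs_of_nonneg hy, abs_of_nonneg (hζ0 n)]
      have h1 : y * |x| * |u| ≤ y * |x| * (C * m1) :=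
        mul_le_mul_of_nonneg_left (hu.trans hA) hys
      have h2 : ζ n * |v| ≤ 1 * |v| := mul_le_mul_of_nonneg_right (hζ1 n) (abs_nonneg v)
      nlinarith
    -- The relative perturbations do not exceed one, so each step of the recurrence for `p` costs at
    -- most a factor `2` more than for `q`.
    have hκn : κ * (n + 1) ≤ 1 := by
      refine le_trans (mul_le_mul_of_nonneg_left ?_ hκ) hκL
      exact_mod_cast (by omega : n + 1 ≤ L)
    have hp2 : (0 : ℝ) < 2 ^ n := by positivity
    have hn0 : (0 : ℝ) ≤ n := by positivity
    have hP : |y * x * p (n + 1)| + |ζ n * p n| ≤ 2 ^ (n + 1) * (m1 * (1 + y * |x|)) := by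
      refine key _ _ _ _ _ b2 a2 le_rfl ?_
      rw [pow_succ]
      nlinarith [mul_le_mul_of_nonneg_left hm01 hp2.le, mul_pos hp2 hm1]
    have hEP : |ε n * (y * x * p (n + 1)) - ε' n * (ζ n * p n)|
        ≤ κ * (n + 1) * (2 ^ (n + 1) * (m1 * (1 + y * |x|))) := by
      refine (abs_sub _ _).trans ?_
      rw [abs_mul, abs_mul (ε' n)]
      refine le_trans (add_le_add (mul_le_mul_of_nonneg_right (hε n hn) (abs_nonneg _))
        (mul_le_mul_of_nonneg_right (hε' n hn) (abs_nonneg _))) ?_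
      rw [← mul_add]
      exact mul_le_mul_of_nonneg_left hP (by positivity)
    rw [hm]
    refine ⟨?_, ?_, ?_⟩
    · rw [hq n]
      refine (abs_sub _ _).trans ?_
      have := key _ _ 1 _ _ b1 a1 (by linarith) (by linarith)
      linarith
    · have e : p (n + 2) = (y * x * p (n + 1) - ζ n * p n)
          + (ε n * (y * x * p (n + 1)) - ε' n * (ζ n * p n)) := by rw [hp n hn]; ring
      rw [e]
      refine (abs_add_le _ _).trans ?_
      have h1 := (abs_sub (y * x * p (n + 1)) (ζ n * p n)).trans hP
      have h2 : (0 : ℝ) ≤ 2 ^ (n + 1) * (m1 * (1 + y * |x|)) := by positivity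
      have h3 := hEP.trans (mul_le_mul_of_nonneg_right hκn h2)
      calc _ ≤ _ := add_le_add h1 h3
        _ = _ := by ring
    -- The difference solves the unperturbed recurrence with a source of order `κ (n + 1) 2^(n+1)`.
    -- Source and inherited error together stay below `κ (n + 2) 2^(n+2)`.
    · have e : p (n + 2) - q (n + 2)
          = (y * x * (p (n + 1) - q (n + 1)) - ζ n * (p n - q n))
          + (ε n * (y * x * p (n + 1)) - ε' n * (ζ n * p n)) := by rw [hp n hn, hq n]; ring
      rw [e]
      refine (abs_add_le _ _).trans ?_
      have h1 := key _ _ (κ * ((n + 1 : ℕ) * 2 ^ (n + 1))) _ _ b3 a3 le_rfl (by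
        refine mul_le_mul ?_ hm01 hm0.le (by positivity)
        refine mul_le_mul_of_nonneg_left ?_ hκ
        push_cast
        rw [pow_succ]
        nlinarith)
      refine (add_le_add ((abs_sub _ _).trans h1) hEP).trans ?_
      have h2 : (0 : ℝ) ≤ m1 * (1 + y * |x|) := by positivity
      push_cast
      have h3 : 0 ≤ κ * 2 ^ (n + 1) * (m1 * (1 + y * |x|)) := by positivity
      rw [pow_succ 2 (n + 1)]
      nlinarith

/-! ### The normalized polynomials -/

/-- The normalization constant of the Hermite polynomials. -/
noncomputable def hermiteNorm (n : ℕ) : ℝ := 1 / (2 ^ (n / 2 : ℝ) * √(n.factorial))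

lemma hermiteNorm_succ (n : ℕ) : hermiteNorm (n + 1) = hermiteNorm n / √(2 * (n + 1)) := by
  unfold hermiteNorm
  rw [Nat.factorial_succ, show (((n + 1 : ℕ) : ℝ) / 2) = n / 2 + 1 / 2 by push_cast; ring,
    Real.rpow_add (by norm_num), ← Real.sqrt_eq_rpow]
  push_cast
  rw [Real.sqrt_mul (by positivity), Real.sqrt_mul (by norm_num)]
  field_simp

/-- This is `Γ(z + 1) = z Γ(z)` at `z = 2 / h² - n = (2 / h²) (1 - h² n / 2)`, which is positive
because `h² n < 2`. -/
lemma alpha_succ {h : ℝ} (hh : 0 < h) {n : ℕ} (hn : h ^ 2 * n < 2) :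
    alpha (n + 1) h = alpha n h / (√(2 * (n + 1)) * √(1 - h ^ 2 * (n / 2))) := by
  unfold alpha
  have h0 : 0 < 2 / h ^ 2 - n := by
    rw [sub_pos, lt_div_iff₀ (by positivity)]; linarith
  have e1 : Real.Gamma (1 + 2 / h ^ 2 - n)
      = (2 / h ^ 2 - n) * Real.Gamma (1 + 2 / h ^ 2 - (n + 1 : ℕ)) := by
    rw [show (1 + 2 / h ^ 2 - ((n + 1 : ℕ) : ℝ)) = 2 / h ^ 2 - n by push_cast; ring,
      ← Real.Gamma_add_one h0.ne']
    congr 1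
    ring
  have e2 : √(2 / h ^ 2 - n) = √2 * √(1 - h ^ 2 * (n / 2)) / h := by
    rw [← Real.sqrt_mul (by norm_num), eq_div_iff hh.ne']
    calc √(2 / h ^ 2 - n) * h = √(2 / h ^ 2 - n) * √(h ^ 2) := by rw [Real.sqrt_sq hh.le]
      _ = _ := by
        rw [← Real.sqrt_mul h0.le]
        congr 1
        field_simp
  have hc : 0 < √(1 - h ^ 2 * (n / 2)) := Real.sqrt_pos.2 (by linarith)
  rw [e1, mul_div_assoc (2 / h ^ 2 - (n : ℝ)), Real.sqrt_mul h0.le, e2, Nat.factorial_succ]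
  push_cast
  rw [Real.sqrt_mul (by positivity), Real.sqrt_mul (by norm_num)]
  generalize √(1 - h ^ 2 * ((n : ℝ) / 2)) = c at hc ⊢
  rw [pow_succ]
  field_simp

lemma two_div_sqrt_two_mul {t : ℝ} (ht : 0 < t) : 2 / √(2 * t) = √(2 / t) := by
  rw [Real.sqrt_mul (by norm_num), Real.sqrt_div (by norm_num)]
  have : √2 * √2 = 2 := Real.mul_self_sqrt (by norm_num)
  field_simp
  nlinarith

lemma two_mul_div_sqrt_mul_sqrt {s t : ℝ} (hs : 0 < s) (ht : 0 < t) :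
    2 * s / (√(2 * s) * √(2 * t)) = √(s / t) := by
  rw [Real.sqrt_mul (by norm_num), Real.sqrt_mul (by norm_num), Real.sqrt_div hs.le]
  have h1 : √2 * √2 = 2 := Real.mul_self_sqrt (by norm_num)
  have h2 : √s * √s = s := Real.mul_self_sqrt hs.le
  field_simp
  rw [sq, sq, h1, h2]

lemma hermiteNorm_mul_rec (n : ℕ) (x : ℝ) :
    hermiteNorm (n + 2) * hermitePoly (n + 2) x
      = √(2 / ((n + 1 : ℕ) + 1)) * x * (hermiteNorm (n + 1) * hermitePoly (n + 1) x)
        - √((n + 1) / (n + 2)) * (hermiteNorm n * hermitePoly n x) := by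
  have e1 := hermiteNorm_succ (n + 1)
  have e0 := hermiteNorm_succ n
  push_cast at e1 ⊢
  have e2 : hermiteNorm (n + 2) = hermiteNorm n / √(2 * (n + 1)) / √(2 * (n + 1 + 1)) := by
    rw [← e0]; exact e1
  rw [hermitePoly, mul_sub, ← two_div_sqrt_two_mul (by positivity),
    ← two_mul_div_sqrt_mul_sqrt (by positivity) (by positivity),
    show (n : ℝ) + 2 = n + 1 + 1 by ring]
  congr 1
  · rw [show n + 2 = n + 1 + 1 from rfl, e1]
    ring
  · rw [e2]
    field_simp

/-- The recurrence of `hermiteNorm_mul_rec`, except for two factors that tend to `1` with `h`; this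
is the perturbed form required by `three_term_bounds`. -/
lemma alpha_mul_rec {h : ℝ} (hh : 0 < h) (n : ℕ) (hn : h ^ 2 * (n + 1) < 2) (x : ℝ) :
    alpha (n + 2) h * kravchukPoly h (n + 2) x
      = 1 / √(1 - h ^ 2 * ((n + 1) / 2)) *
          (√(2 / ((n + 1 : ℕ) + 1)) * x * (alpha (n + 1) h * kravchukPoly h (n + 1) x))
        - √(1 - h ^ 2 * (n / 2)) / √(1 - h ^ 2 * ((n + 1) / 2)) *
          (√((n + 1) / (n + 2)) * (alpha n h * kravchukPoly h n x)) := by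
  have hh2 : 0 < h ^ 2 := by positivity
  have e1 := alpha_succ hh (n := n + 1) (by push_cast; exact hn)
  have e0 := alpha_succ hh (n := n) (by nlinarith)
  push_cast at e1 ⊢
  have e2 : alpha (n + 2) h = alpha n h / (√(2 * (n + 1)) * √(1 - h ^ 2 * (n / 2)))
      / (√(2 * (n + 1 + 1)) * √(1 - h ^ 2 * ((n + 1) / 2))) := by
    rw [← e0]; exact e1
  have hc0 : 0 < 1 - h ^ 2 * ((n : ℝ) / 2) := by nlinarith
  have hc1 : 0 < 1 - h ^ 2 * (((n : ℝ) + 1) / 2) := by nlinarith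
  have hs : 1 - h ^ 2 * ((n : ℝ) / 2) = √(1 - h ^ 2 * (n / 2)) * √(1 - h ^ 2 * (n / 2)) :=
    (Real.mul_self_sqrt hc0.le).symm
  have hs0 := Real.sqrt_pos.2 hc0
  have hs1 := Real.sqrt_pos.2 hc1
  rw [kravchukPoly, mul_sub, ← two_div_sqrt_two_mul (by positivity),
    ← two_mul_div_sqrt_mul_sqrt (by positivity) (by positivity),
    show (n : ℝ) + 2 = n + 1 + 1 by ring]
  congr 1
  · rw [show n + 2 = n + 1 + 1 from rfl, e1]
    field_simp
  · rw [e2]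
    generalize √(1 - h ^ 2 * ((n : ℝ) / 2)) = c at *
    rw [hs]
    field_simp

lemma one_le_one_div_sqrt_one_sub {t : ℝ} (ht0 : 0 ≤ t) (ht : t ≤ 1 / 2) :
    1 ≤ 1 / √(1 - t) ∧ 1 / √(1 - t) ≤ 1 + 2 * t := by
  have h1 : 0 < √(1 - t) := Real.sqrt_pos.2 (by linarith)
  constructor
  · rw [one_le_div h1]; exact Real.sqrt_le_iff.2 ⟨zero_le_one, by linarith⟩
  · rw [div_le_iff₀ h1]
    have h2 : 1 / (1 + 2 * t) ≤ √(1 - t) := by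
      apply Real.le_sqrt_of_sq_le
      rw [div_pow, one_pow, div_le_iff₀ (by positivity)]
      nlinarith [mul_nonneg ht0 (sub_nonneg.2 ht), mul_nonneg (mul_nonneg ht0 ht0) (sub_nonneg.2 ht)]
    rw [div_le_iff₀ (by positivity)] at h2
    linarith

/-- `three_term_bounds` applies with `κ = h²`: for `t = h² (j + 1) / 2 ≤ 1/2` both perturbing
factors lie between `1` and `1 + 2t`. -/
lemma normalized_poly_bounds {h : ℝ} (hh : 0 < h) {n : ℕ} (hn : h ^ 2 * n ≤ 1) (x : ℝ) :
    |hermiteNorm n * hermitePoly n x| ≤ majorant |x| n ∧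
      |alpha n h * kravchukPoly h n x - hermiteNorm n * hermitePoly n x|
        ≤ h ^ 2 * (n * 2 ^ n) * majorant |x| n := by
  have hh2 : 0 < h ^ 2 := by positivity
  have hα0 : alpha 0 h = 1 := by
    have : Real.Gamma (1 + 2 / h ^ 2) ≠ 0 := (Real.Gamma_pos_of_pos (by positivity)).ne'
    simp [alpha, this]
  have hN0 : hermiteNorm 0 = 1 := by simp [hermiteNorm]
  have hs2 : 2 / √2 = √2 := by
    simp
  have hN1 : hermiteNorm 1 * 2 = √2 := by
    have := hermiteNorm_succ 0
    rw [hN0] at this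
    norm_num at this
    rw [this, inv_mul_eq_div, hs2]
  have hα1 : alpha 1 h * 2 = √2 := by
    have := alpha_succ hh (n := 0) (by norm_num)
    rw [hα0] at this
    norm_num at this
    rw [this, inv_mul_eq_div, hs2]
  have hsmall : ∀ j : ℕ, j + 2 ≤ n → h ^ 2 * ((j : ℝ) + 1) ≤ 1 := fun j hj =>
    le_trans (mul_le_mul_of_nonneg_left (by exact_mod_cast (by omega : j + 1 ≤ n)) hh2.le) hn
  have key := three_term_bounds (x := x) (κ := h ^ 2) hh2.le (L := n)
    (p := fun n => alpha n h * kravchukPoly h n x)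
    (q := fun n => hermiteNorm n * hermitePoly n x)
    (ε := fun j => 1 / √(1 - h ^ 2 * ((j + 1) / 2)) - 1)
    (ε' := fun j => √(1 - h ^ 2 * (j / 2)) / √(1 - h ^ 2 * ((j + 1) / 2)) - 1)
    (ζ := fun j => √((j + 1) / (j + 2))) hn
    (by simp [hα0, kravchukPoly]) (by simp [hN0, hermitePoly])
    (by simp only [kravchukPoly]; rw [← hα1]; ring)
    (by simp only [hermitePoly]; rw [← hN1]; ring)
    (fun j => Real.sqrt_nonneg _)
    (fun j => by
      rw [Real.sqrt_le_iff, one_pow, div_le_one (by positivity)]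
      exact ⟨zero_le_one, by linarith⟩)
    (fun j hj => by
      have h1 := hsmall j hj
      obtain ⟨h2, h3⟩ := one_le_one_div_sqrt_one_sub (t := h ^ 2 * (((j : ℝ) + 1) / 2))
        (by positivity) (by linarith)
      rw [abs_of_nonneg (by linarith)]
      linarith)
    (fun j hj => by
      have h1 := hsmall j hj
      obtain ⟨h2, h3⟩ := one_le_one_div_sqrt_one_sub (t := h ^ 2 * (((j : ℝ) + 1) / 2))
        (by positivity) (by linarith)
      have h4 : 0 < √(1 - h ^ 2 * (((j : ℝ) + 1) / 2)) := Real.sqrt_pos.2 (by linarith)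
      have h5 : 1 ≤ √(1 - h ^ 2 * ((j : ℝ) / 2)) / √(1 - h ^ 2 * (((j : ℝ) + 1) / 2)) := by
        rw [one_le_div h4]
        exact Real.sqrt_le_sqrt (by nlinarith)
      have h6 : √(1 - h ^ 2 * ((j : ℝ) / 2)) / √(1 - h ^ 2 * (((j : ℝ) + 1) / 2))
          ≤ 1 / √(1 - h ^ 2 * (((j : ℝ) + 1) / 2)) := by
        refine div_le_div_of_nonneg_right ?_ h4.le
        have : 0 ≤ h ^ 2 * ((j : ℝ) / 2) := by positivity
        exact Real.sqrt_le_iff.2 ⟨zero_le_one, by linarith⟩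
      rw [abs_of_nonneg (by linarith)]
      linarith)
    (fun j => hermiteNorm_mul_rec j x)
    (fun j hj => by
      rw [add_sub_cancel, add_sub_cancel]
      exact alpha_mul_rec hh j (by linarith [hsmall j hj]) x)
    le_rfl
  exact ⟨key.1, key.2.2⟩

end Kravchuk

namespace Kravchuk

/-! ### Convergence of the Kravchuk functions -/

/-- Continuous functions that agree almost everywhere agree everywhere, so the choice made in
`contRep` is immaterial. -/
lemma contRep_eq {f u : ℝ → ℂ} (hu : Continuous u) (hfu : f =ᵐ[volume] u) : contRep f = u := by
  have H : ∃ u : ℝ → ℂ, Continuous u ∧ f =ᵐ[volume] u := ⟨u, hu, hfu⟩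
  rw [contRep, dif_pos H]
  exact (H.choose_spec.1.ae_eq_iff_eq volume hu).1 (H.choose_spec.2.symm.trans hfu)

lemma exists_japanese_rpow_mul_exp_le (σ : ℝ) :
    ∃ C : ℝ, 0 < C ∧ ∀ x : ℝ,
      japanese x ^ σ * ((1 + x ^ 2) ^ 2 * Real.exp (-x ^ 2 / 4)) ≤ C * (1 + x ^ 2)⁻¹ := by
  obtain ⟨n, hn⟩ := exists_nat_ge σ
  -- Of the `n + 3` powers of `1 + x²`, `n` bound the bracket, two are given and one is the decay.
  -- The exponential series is used at `(1 + x²) / 4`, which leaves the constant `exp(1/4)`.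
  refine ⟨(n + 3).factorial * 4 ^ (n + 3) * Real.exp (1 / 4), by positivity, fun x => ?_⟩
  have hx : 0 < 1 + x ^ 2 := by positivity
  have h1 : japanese x ^ σ ≤ (1 + x ^ 2) ^ n := by
    have hj : 1 ≤ japanese x := by
      rw [japanese, Real.one_le_sqrt]; nlinarith [sq_nonneg x]
    calc japanese x ^ σ ≤ japanese x ^ ((2 * n : ℕ) : ℝ) := by
          refine Real.rpow_le_rpow_of_exponent_le hj (hn.trans ?_)
          push_cast
          linarith [(Nat.cast_nonneg n : (0 : ℝ) ≤ n)]
      _ = _ := by rw [Real.rpow_natCast, pow_mul, japanese, Real.sq_sqrt hx.le]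
  have h2 : (1 + x ^ 2) ^ (n + 3)
      ≤ (n + 3).factorial * 4 ^ (n + 3) * (Real.exp (1 / 4) * Real.exp (x ^ 2 / 4)) := by
    have := Real.pow_div_factorial_le_exp ((1 + x ^ 2) / 4) (by positivity) (n + 3)
    rw [div_pow, div_div, div_le_iff₀ (by positivity), add_div, Real.exp_add] at this
    linarith
  rw [← div_eq_mul_inv, le_div_iff₀ hx]
  calc _ ≤ (1 + x ^ 2) ^ n * ((1 + x ^ 2) ^ 2 * Real.exp (-x ^ 2 / 4)) * (1 + x ^ 2) := by gcongr
    _ = (1 + x ^ 2) ^ (n + 3) * Real.exp (-x ^ 2 / 4) := by ring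
    _ ≤ _ := mul_le_mul_of_nonneg_right h2 (Real.exp_pos _).le
    _ = _ := by
      rw [mul_assoc, mul_assoc (Real.exp _), ← Real.exp_add,
        show x ^ 2 / 4 + -x ^ 2 / 4 = 0 by ring, Real.exp_zero, mul_one]

lemma hasDerivAt_inv_one_add_sq (x : ℝ) :
    HasDerivAt (fun x : ℝ => (1 + x ^ 2)⁻¹) (-(2 * x) / (1 + x ^ 2) ^ 2) x := by
  have h := ((hasDerivAt_pow 2 x).const_add 1).fun_inv (by positivity : (1 + x ^ 2) ≠ 0)
  simpa using h

/-- Gaussian bounds on the grid give bounds of the weighted `ℓ²` norm. -/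
lemma exists_ell2Norm_le_of_gaussian (σ : ℝ) :
    ∃ C : ℝ, 0 < C ∧ ∀ h : ℝ, 0 < h → h ≤ 1 → ∀ D : ℝ, 0 ≤ D → ∀ u : Grid h → ℂ,
      (∀ a : Grid h, ‖u a‖ ≤ japanese a ^ σ *
        (D * ((1 + (a : ℝ) ^ 2) ^ 2 * Real.exp (-(a : ℝ) ^ 2 / 4)))) →
      ell2Norm h u ≤ ENNReal.ofReal (C * D) := by
  obtain ⟨C, hC, hb⟩ := exists_japanese_rpow_mul_exp_le σ
  -- Here `20 = 2 · 5 · 2`: the local Sobolev constant, the bound `f² + f'² ≤ 5f` for `f = (1 +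
  -- x²)⁻¹`, and the double covering. The integral of `f` is `π`.
  refine ⟨√(20 * Real.pi) * C, by positivity, fun h hh h1 D hD u hu => ?_⟩
  refine ell2Norm_le_of_sq_le hh ?_
  have hfc : Continuous fun x : ℝ => (1 + x ^ 2)⁻¹ :=
    (by fun_prop : Continuous fun x : ℝ => 1 + x ^ 2).inv₀ fun x => by positivity
  have hf'c : Continuous fun x : ℝ => -(2 * x) / (1 + x ^ 2) ^ 2 :=
    (by fun_prop : Continuous fun x : ℝ => -(2 * x)).div (by fun_prop) fun x => by positivity
  have key : ∀ k : ℤ, h * ‖u (gridEquiv hh k)‖ ^ 2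
      ≤ 10 * (C * D) ^ 2 * ∫ t in (k * h - h)..(k * h + h), (1 + t ^ 2)⁻¹ := by
    intro k
    set a := gridEquiv hh k
    have ha : (a : ℝ) = k * h := rfl
    have e1 : ‖u a‖ ≤ C * D * (1 + (a : ℝ) ^ 2)⁻¹ := by
      refine (hu a).trans ?_
      have := mul_le_mul_of_nonneg_left (hb a) hD
      linarith
    have e2 := mul_sq_le_integral (a := k * h) hh h1 hasDerivAt_inv_one_add_sq hf'c
      (x := a) (by rw [ha]; constructor <;> linarith)
    have e3 : ∫ t in (k * h - h)..(k * h + h),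
        (((1 + t ^ 2)⁻¹) ^ 2 + (-(2 * t) / (1 + t ^ 2) ^ 2) ^ 2)
        ≤ ∫ t in (k * h - h)..(k * h + h), 5 * (1 + t ^ 2)⁻¹ := by
      refine intervalIntegral.integral_mono_on (by linarith)
        ((by fun_prop : Continuous fun t : ℝ => ((1 + t ^ 2)⁻¹) ^ 2
          + (-(2 * t) / (1 + t ^ 2) ^ 2) ^ 2).intervalIntegrable _ _)
        ((by fun_prop : Continuous fun t : ℝ => 5 * (1 + t ^ 2)⁻¹).intervalIntegrable _ _)
        fun t _ => ?_
      have hy0 : 0 < (1 + t ^ 2)⁻¹ := by positivity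
      have hy1 : (1 + t ^ 2)⁻¹ ≤ 1 := inv_le_one_of_one_le₀ (by nlinarith [sq_nonneg t])
      have hy2 : t ^ 2 * (1 + t ^ 2)⁻¹ ≤ 1 := by
        rw [← div_eq_mul_inv, div_le_one (by positivity)]; linarith
      have e4 : (-(2 * t) / (1 + t ^ 2) ^ 2) ^ 2
          = 4 * (t ^ 2 * (1 + t ^ 2)⁻¹) * ((1 + t ^ 2)⁻¹ * (1 + t ^ 2)⁻¹) * (1 + t ^ 2)⁻¹ := by
        field_simp
        ring
      rw [e4]
      generalize (1 + t ^ 2)⁻¹ = y at *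
      have hyy : y * y ≤ 1 := by nlinarith
      have h5 : t ^ 2 * y * (y * y) ≤ 1 := by
        have : 0 ≤ t ^ 2 * y := by positivity
        nlinarith
      nlinarith [mul_le_mul_of_nonneg_right h5 hy0.le]
    rw [intervalIntegral.integral_const_mul] at e3
    have e5 : h * ((1 + (a : ℝ) ^ 2)⁻¹) ^ 2
        ≤ 10 * ∫ t in (k * h - h)..(k * h + h), (1 + t ^ 2)⁻¹ := by
      refine e2.trans ?_
      linarith
    calc h * ‖u a‖ ^ 2 ≤ h * (C * D * (1 + (a : ℝ) ^ 2)⁻¹) ^ 2 := by gcongr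
      _ = (C * D) ^ 2 * (h * ((1 + (a : ℝ) ^ 2)⁻¹) ^ 2) := by ring
      _ ≤ (C * D) ^ 2 * (10 * ∫ t in (k * h - h)..(k * h + h), (1 + t ^ 2)⁻¹) := by gcongr
      _ = _ := by ring
  refine (tsum_ofReal_le hh hfc (fun x => by positivity) (by positivity) key).trans (le_of_eq ?_)
  rw [← ofReal_integral_eq_lintegral_ofReal integrable_inv_one_add_sq
    (ae_of_all _ fun x => by positivity), integral_univ_inv_one_add_sq,
    ← ENNReal.ofReal_mul (by positivity), ← ENNReal.ofReal_pow (by positivity)]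
  congr 1
  rw [mul_pow (√(20 * Real.pi) * C), mul_pow (√(20 * Real.pi)), Real.sq_sqrt (by positivity)]
  ring

/-- The ground state of the harmonic oscillator. -/
noncomputable def gaussian (x : ℝ) : ℝ := (Real.pi ^ (1 / 4 : ℝ))⁻¹ * Real.exp (-x ^ 2 / 2)

lemma gaussian_pos (x : ℝ) : 0 < gaussian x := by unfold gaussian; positivity

lemma gaussian_sq (x : ℝ) : gaussian x ^ 2 = 1 / √Real.pi * Real.exp (-x ^ 2) := by
  rw [gaussian, mul_pow, inv_pow, ← Real.rpow_natCast, ← Real.rpow_mul Real.pi_pos.le,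
    ← Real.exp_nat_mul, Real.sqrt_eq_rpow, one_div]
  congr 2
  · norm_num
  · push_cast
    ring

lemma gaussian_le (x : ℝ) : gaussian x ≤ Real.exp (-x ^ 2 / 2) := by
  refine mul_le_of_le_one_left (Real.exp_pos _).le (inv_le_one_of_one_le₀ ?_)
  exact Real.one_le_rpow (by linarith [Real.pi_gt_three]) (by norm_num)

lemma hermiteFun_eq (n : ℕ) (x : ℝ) :
    hermiteFun n x = hermiteNorm n * hermitePoly n x * gaussian x := by
  unfold hermiteFun hermiteNorm gaussian
  field_simp

lemma continuous_hermitePoly (n : ℕ) : Continuous (hermitePoly n) := by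
  induction n using Nat.strong_induction_on with
  | _ n ih =>
  match n, ih with
  | 0, _ => exact (continuous_const (y := (1 : ℝ))).congr fun x => by simp [hermitePoly]
  | 1, _ => exact (continuous_const_mul (2 : ℝ)).congr fun x => by simp [hermitePoly]
  | n + 2, ih =>
    have h0 := ih n (by omega)
    have h1 := ih (n + 1) (by omega)
    have : hermitePoly (n + 2)
        = fun x => 2 * x * hermitePoly (n + 1) x - 2 * (n + 1) * hermitePoly n x := by
      funext x; simp [hermitePoly]
    rw [this]
    fun_prop

lemma gridProj_hermiteFun (h : ℝ) (n : ℕ) (a : Grid h) :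
    gridProj h (fun x => (hermiteFun n x : ℂ)) a = (hermiteFun n a : ℂ) := by
  have hc : Continuous fun x => (hermiteFun n x : ℂ) := by
    have := continuous_hermitePoly n
    unfold hermiteFun
    fun_prop
  rw [gridProj, contRep_eq hc (ae_eq_refl _)]

/-! ### Pointwise comparison of the weights and of the functions -/

section comparison

variable {M : ℕ} {h : ℝ}

lemma rho_nonneg (hh : 0 < h) (a : Grid h) : 0 ≤ rho h a := by
  unfold rho
  split_ifs with ha
  · have h1 : |(a : ℝ) / h| ≤ 1 / h ^ 2 := by
      rw [abs_div, abs_of_pos hh, div_le_iff₀ hh]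
      refine ha.trans (le_of_eq ?_)
      field_simp
    have h2 := abs_le.1 h1
    have g1 := Real.Gamma_pos_of_pos (by linarith : 0 < 1 + 1 / h ^ 2 + a / h)
    have g2 := Real.Gamma_pos_of_pos (by linarith : 0 < 1 + 1 / h ^ 2 - a / h)
    have g3 := Real.Gamma_pos_of_pos (by positivity : 0 < 1 + 2 / h ^ 2)
    positivity
  · exact le_rfl

lemma abs_rho_sub_le (hM : 0 < M) (hh : 0 < h) (hM2 : h ^ 2 = 1 / M) (a : Grid h) :
    |rho h a - 1 / √Real.pi * Real.exp (-(a : ℝ) ^ 2)|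
      ≤ 2 * h ^ 2 * (1 + (a : ℝ) ^ 2) ^ 2 * gaussian a ^ 2 := by
  have h1 := abs_rho_mul_exp_sub_one_le hM hh hM2 a
  have e : rho h a - 1 / √Real.pi * Real.exp (-(a : ℝ) ^ 2)
      = (√Real.pi * rho h a * Real.exp ((a : ℝ) ^ 2) - 1) * gaussian a ^ 2 := by
    rw [gaussian_sq, Real.exp_neg]
    have : √Real.pi ≠ 0 := by positivity
    field_simp
  rw [e, abs_mul, abs_of_nonneg (sq_nonneg (gaussian a))]
  exact mul_le_mul_of_nonneg_right h1 (sq_nonneg _)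

/-- In `ρ - g² = (√ρ - g) (√ρ + g)` the second factor is at least `g`; dividing by it keeps the
relative error. -/
lemma abs_sqrt_rho_sub_le (hM : 0 < M) (hh : 0 < h) (hM2 : h ^ 2 = 1 / M) (a : Grid h) :
    |√(rho h a) - gaussian a| ≤ 2 * h ^ 2 * (1 + (a : ℝ) ^ 2) ^ 2 * gaussian a := by
  have h1 := abs_rho_sub_le hM hh hM2 a
  have hg := gaussian_pos a
  rw [← gaussian_sq] at h1
  have hs := Real.sqrt_nonneg (rho h a)
  have e : rho h a - gaussian a ^ 2 = (√(rho h a) - gaussian a) * (√(rho h a) + gaussian a) := by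
    have := Real.sq_sqrt (rho_nonneg hh a)
    nlinarith
  rw [e, abs_mul, abs_of_pos (by positivity : 0 < √(rho h a) + gaussian a)] at h1
  refine le_of_mul_le_mul_right ?_ hg
  calc _ ≤ |√(rho h a) - gaussian a| * (√(rho h a) + gaussian a) := by
        gcongr; linarith
    _ ≤ _ := h1
    _ = _ := by ring

/-- Pointwise comparison of Kravchuk and Hermite functions. -/
lemma abs_kravchukFun_sub_le (hM : 0 < M) (hh : 0 < h) (h1 : h ≤ 1) (hM2 : h ^ 2 = 1 / M)
    {n : ℕ} (hn : h ^ 2 * n ≤ 1) (a : Grid h) :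
    |kravchukFun n h a - hermiteFun n a|
      ≤ 5 * h ^ 2 * 16 ^ n * ((1 + (a : ℝ) ^ 2) ^ 2 * Real.exp (-(a : ℝ) ^ 2 / 4)) := by
  obtain ⟨hq, hd⟩ := normalized_poly_bounds hh hn a
  have hr := abs_sqrt_rho_sub_le hM hh hM2 a
  have hm := majorant_le (abs_nonneg (a : ℝ)) n
  have hm0 := majorant_pos (abs_nonneg (a : ℝ)) n
  have hg := gaussian_pos a
  rw [hermiteFun_eq, kravchukFun]
  set p := alpha n h * kravchukPoly h n a
  set q := hermiteNorm n * hermitePoly n a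
  set m := majorant |(a : ℝ)| n
  set W := (1 + (a : ℝ) ^ 2) ^ 2 with hW
  have hW1 : 1 ≤ W := one_le_pow₀ (by nlinarith [sq_nonneg (a : ℝ)])
  have hh2 : h ^ 2 ≤ 1 := pow_le_one₀ hh.le h1
  have hn4 : (n : ℝ) * 2 ^ n ≤ 4 ^ n := by
    have : (n : ℝ) ≤ 2 ^ n := by exact_mod_cast Nat.lt_two_pow_self.le
    calc (n : ℝ) * 2 ^ n ≤ 2 ^ n * 2 ^ n := by gcongr
      _ = 4 ^ n := by rw [← mul_pow]; norm_num
  have hd' : |p - q| ≤ h ^ 2 * 4 ^ n * m := hd.trans (by gcongr)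
  have hrho : √(rho h a) ≤ 3 * W * gaussian a := by
    have e1 := (abs_le.1 hr).2
    have e2 : h ^ 2 * W ≤ 1 * W := by gcongr
    nlinarith [mul_le_mul_of_nonneg_right e2 hg.le, mul_le_mul_of_nonneg_right hW1 hg.le]
  have h4 : (1 : ℝ) ≤ 4 ^ n := one_le_pow₀ (by norm_num)
  -- The polynomial error meets `√ρ ≤ 3 W g` and the weight error `2 h² W g` meets the Hermite
  -- polynomial, whence `5 = 3 + 2`. One `4^n` comes from `n 2^n ≤ 4^n`, the other from the
  -- majorant.
  have e : p * √(rho h a) - q * gaussian a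
      = (p - q) * √(rho h a) + q * (√(rho h a) - gaussian a) := by ring
  rw [e]
  calc |(p - q) * √(rho h a) + q * (√(rho h a) - gaussian a)|
      ≤ |p - q| * √(rho h a) + |q| * |√(rho h a) - gaussian a| := by
        refine (abs_add_le _ _).trans ?_
        rw [abs_mul, abs_mul q, abs_of_nonneg (Real.sqrt_nonneg _)]
    _ ≤ h ^ 2 * 4 ^ n * m * (3 * W * gaussian a) + 4 ^ n * m * (2 * h ^ 2 * W * gaussian a) := by
        gcongr
        exact hq.trans (le_mul_of_one_le_left hm0.le h4)
    _ = 5 * h ^ 2 * 4 ^ n * W * (m * gaussian a) := by ring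
    _ ≤ 5 * h ^ 2 * 4 ^ n * W *
        (4 ^ n * Real.exp (|(a : ℝ)| ^ 2 / 4) * Real.exp (-(a : ℝ) ^ 2 / 2)) := by
        gcongr
        exact gaussian_le a
    _ = _ := by
        rw [mul_assoc (4 ^ n), ← Real.exp_add, sq_abs,
          show (a : ℝ) ^ 2 / 4 + -(a : ℝ) ^ 2 / 2 = -(a : ℝ) ^ 2 / 4 by ring,
          show (16 : ℝ) = 4 * 4 by norm_num, mul_pow]
        ring

end comparison

/-- The constant `1/3` in the range of `n` enters here: `16 ≤ e³` and `3n ≤ δ |log h|`. -/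
lemma sixteen_pow_le_rpow_neg {h δ : ℝ} (hh : 0 < h) {n : ℕ} (h1 : h ≤ 1)
    (hn : (n : ℝ) ≤ 1 / 3 * δ * |Real.log h|) : (16 : ℝ) ^ n ≤ h ^ (-δ) := by
  have hlog : |Real.log h| = -Real.log h := abs_of_nonpos (Real.log_nonpos hh.le h1)
  rw [hlog] at hn
  have he : (16 : ℝ) ≤ Real.exp 3 := by
    have e1 := Real.exp_one_gt_d9
    have e2 : Real.exp 3 = Real.exp 1 ^ 3 := by rw [← Real.exp_nat_mul]; norm_num
    rw [e2]
    calc (16 : ℝ) ≤ 2.7 ^ 3 := by norm_num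
      _ ≤ _ := by gcongr; linarith
  calc (16 : ℝ) ^ n ≤ Real.exp 3 ^ n := by gcongr
    _ = Real.exp (n * 3) := by rw [← Real.exp_nat_mul]
    _ ≤ Real.exp (Real.log h * (-δ)) := by rw [Real.exp_le_exp]; linarith
    _ = h ^ (-δ) := (Real.rpow_def_of_pos hh _).symm

lemma mesh_eq_of_even {N : ℕ} (hN : 0 < N) (hN' : Even N) :
    ∃ M : ℕ, 0 < M ∧ mesh N ^ 2 = 1 / M ∧ mesh N ≤ 1 := by
  obtain ⟨M, rfl⟩ := hN'
  have hM : 0 < M := by omega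
  have h2 : mesh (M + M) ^ 2 = 1 / M := by rw [← two_mul]; exact mesh_two_mul_sq
  refine ⟨M, hM, h2, ?_⟩
  have h3 : mesh (M + M) ^ 2 ≤ 1 := by
    rw [h2, div_le_one (by exact_mod_cast hM)]
    exact_mod_cast hM
  have := mesh_pos hN
  nlinarith

/-- Convergence of the binomial weight and of the Kravchuk functions. -/
theorem kravchuk_convergence (δ : ℝ) (hδ0 : 0 < δ) (hδ1 : δ < 1) (σ : ℝ) :
    ∃ (C : ℝ) (N₀ : ℕ), ∀ N : ℕ, N₀ ≤ N → Even N → ∀ h : ℝ, h = mesh N →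
      ell2Norm h
          (fun a => ((japanese a ^ σ *
            (rho h a - 1 / √Real.pi * Real.exp (-(a : ℝ) ^ 2)) : ℝ) : ℂ))
        ≤ ENNReal.ofReal (C * h ^ (2 - δ)) ∧
      ∀ n : ℕ, (n : ℝ) ≤ 1 / 3 * δ * |Real.log h| →
        ell2Norm h
            (fun a => ((japanese a ^ σ : ℝ) : ℂ) *
              ((kravchukFun n h a : ℂ)
                - gridProj h (fun x => (hermiteFun n x : ℂ)) a))
          ≤ ENNReal.ofReal (C * h ^ (2 - δ)) := by
  obtain ⟨C, hC, hb⟩ := exists_ell2Norm_le_of_gaussian σ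
  -- The `5` is that of `abs_kravchukFun_sub_le` and also covers the `2` needed for the weight. `N₀
  -- = 1` suffices because `h ≤ 1` for every positive even `N`.
  refine ⟨C * 5, 1, fun N hN hNe h hh => ?_⟩
  obtain ⟨M, hM, hM2, h1⟩ := mesh_eq_of_even hN hNe
  have h0 := mesh_pos hN
  rw [← hh] at hM2 h1 h0
  have hj : ∀ a : Grid h, 0 ≤ japanese a ^ σ := fun a => by unfold japanese; positivity
  have hrp : h ^ (2 - δ) = h ^ 2 * h ^ (-δ) := by
    rw [sub_eq_add_neg, Real.rpow_add h0]; norm_num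
  have hone : 1 ≤ h ^ (-δ) := Real.one_le_rpow_of_pos_of_le_one_of_nonpos h0 h1 (by linarith)
  constructor
  · refine (hb h h0 h1 (2 * h ^ 2) (by positivity) _ fun a => ?_).trans
      (ENNReal.ofReal_le_ofReal ?_)
    · rw [Complex.norm_real, Real.norm_eq_abs, abs_mul, abs_of_nonneg (hj a)]
      refine mul_le_mul_of_nonneg_left ((abs_rho_sub_le hM h0 hM2 a).trans ?_) (hj a)
      rw [mul_assoc]
      have hg : gaussian a ^ 2 ≤ Real.exp (-(a : ℝ) ^ 2 / 4) := by
        refine (pow_le_pow_left₀ (gaussian_pos a).le (gaussian_le a) 2).trans ?_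
        rw [← Real.exp_nat_mul, Real.exp_le_exp]
        push_cast
        nlinarith [sq_nonneg (a : ℝ)]
      gcongr
    · rw [hrp]
      have : 0 < h ^ 2 := by positivity
      nlinarith [mul_le_mul_of_nonneg_left hone (by positivity : 0 ≤ C * h ^ 2)]
  · intro n hn
    have h16 := sixteen_pow_le_rpow_neg h0 h1 hn
    -- `n ≤ |log h| ≤ 1 / h`, so that `h² n ≤ h ≤ 1`.
    have hn1 : h ^ 2 * n ≤ 1 := by
      have hlog : |Real.log h| = Real.log h⁻¹ := by
        rw [Real.log_inv, abs_of_nonpos (Real.log_nonpos h0.le h1)]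
      have h2 : Real.log h⁻¹ ≤ h⁻¹ := (Real.log_le_sub_one_of_pos (by positivity)).trans (by linarith)
      have h3 : (n : ℝ) ≤ h⁻¹ := by
        rw [hlog] at hn
        have h4 : 0 ≤ Real.log h⁻¹ := by rw [← hlog]; exact abs_nonneg _
        nlinarith
      calc h ^ 2 * n ≤ h ^ 2 * h⁻¹ := by gcongr
        _ = h := by field_simp
        _ ≤ 1 := h1
    refine (hb h h0 h1 (5 * h ^ 2 * 16 ^ n) (by positivity) _ fun a => ?_).trans
      (ENNReal.ofReal_le_ofReal ?_)
    · rw [gridProj_hermiteFun, ← Complex.ofReal_sub, norm_mul, Complex.norm_real,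
        Complex.norm_real, Real.norm_eq_abs, Real.norm_eq_abs, abs_of_nonneg (hj a)]
      exact mul_le_mul_of_nonneg_left (abs_kravchukFun_sub_le hM h0 h1 hM2 hn1 a) (hj a)
    · rw [hrp]
      calc C * (5 * h ^ 2 * 16 ^ n) ≤ C * (5 * h ^ 2 * h ^ (-δ)) := by gcongr
        _ = _ := by ring

end Kravchuk

namespace Kravchuk

/-! ### Locally absolutely continuous functions -/

/-- `f` is a primitive of the locally integrable function `f'`. -/
structure IsPrimitive (f f' : ℝ → ℝ) : Prop where
  locallyIntegrable : LocallyIntegrable f'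
  eq_add_integral : ∀ x, f x = f 0 + ∫ t in (0 : ℝ)..x, f' t

lemma intervalIntegrable_of_locallyIntegrable {f : ℝ → ℝ} (hf : LocallyIntegrable f) (a b : ℝ) :
    IntervalIntegrable f volume a b :=
  intervalIntegrable_iff.2 <|
    (hf.integrableOn_isCompact isCompact_uIcc).mono_set Set.uIoc_subset_uIcc

lemma isPrimitive_integral {v : ℝ → ℝ} (hv : LocallyIntegrable v) (c : ℝ) :
    IsPrimitive (fun x => c + ∫ t in (0 : ℝ)..x, v t) v :=
  ⟨hv, fun x => by simp⟩

namespace IsPrimitive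

variable {f f' g g' : ℝ → ℝ}

lemma intervalIntegrable (hf : IsPrimitive f f') (a b : ℝ) : IntervalIntegrable f' volume a b :=
  intervalIntegrable_of_locallyIntegrable hf.locallyIntegrable a b

lemma continuous (hf : IsPrimitive f f') : Continuous f := by
  rw [funext hf.eq_add_integral]
  exact continuous_const.add (intervalIntegral.continuous_primitive hf.intervalIntegrable 0)

lemma of_hasDerivAt (hf : ∀ x, HasDerivAt f (f' x) x) (hf' : Continuous f') :
    IsPrimitive f f' :=
  ⟨hf'.locallyIntegrable, fun x => by
    rw [intervalIntegral.integral_eq_sub_of_hasDerivAt (fun t _ => hf t)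
      (hf'.intervalIntegrable _ _)]
    ring⟩

lemma hasDerivAt (hf : IsPrimitive f f') (hf' : Continuous f') (x : ℝ) :
    HasDerivAt f (f' x) x := by
  rw [funext hf.eq_add_integral]
  exact (hf'.integral_hasStrictDerivAt 0 x).hasDerivAt.const_add _

lemma congr_deriv (hf : IsPrimitive f f') (h : f' =ᵐ[volume] g') : IsPrimitive f g' :=
  ⟨hf.locallyIntegrable.congr h, fun x => by
    rw [hf.eq_add_integral x]
    congr 1
    exact intervalIntegral.integral_congr_ae (h.mono fun t ht _ => ht)⟩

lemma ae_hasDerivAt (hf : IsPrimitive f f') : ∀ᵐ x, HasDerivAt f (f' x) x := by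
  filter_upwards [_root_.LocallyIntegrable.ae_hasDerivAt_integral hf.locallyIntegrable] with x hx
  rw [funext hf.eq_add_integral]
  exact (hx 0).const_add _

lemma absolutelyContinuousOnInterval (hf : IsPrimitive f f') (x : ℝ) :
    AbsolutelyContinuousOnInterval f 0 x := by
  rw [funext hf.eq_add_integral]
  exact (contDiff_const.contDiffOn.absolutelyContinuousOnInterval).add
    ((hf.intervalIntegrable 0 x).absolutelyContinuousOnInterval_intervalIntegral (by simp))

/-- `f'` and `g'` are derivatives only almost everywhere, so the product rule is taken from
integration by parts for absolutely continuous functions. -/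
lemma mul (hf : IsPrimitive f f') (hg : IsPrimitive g g') :
    IsPrimitive (fun x => f x * g x) (fun x => f' x * g x + f x * g' x) := by
  refine ⟨?_, fun x => ?_⟩
  · have h1 : LocallyIntegrable (fun x => f' x * g x) := by
      refine (locallyIntegrable_iff).2 fun K hK => ?_
      exact (hf.locallyIntegrable.integrableOn_isCompact hK).mul_continuousOn
        hg.continuous.continuousOn hK
    have h2 : LocallyIntegrable (fun x => f x * g' x) := by
      refine (locallyIntegrable_iff).2 fun K hK => ?_
      exact (hg.locallyIntegrable.integrableOn_isCompact hK).continuousOn_mul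
        hf.continuous.continuousOn hK
    exact h1.add h2
  · have key := (hf.absolutelyContinuousOnInterval x).integral_deriv_mul_eq_sub
      (hg.absolutelyContinuousOnInterval x)
    have e : ∫ t in (0 : ℝ)..x, (deriv f t * g t + f t * deriv g t)
        = ∫ t in (0 : ℝ)..x, (f' t * g t + f t * g' t) := by
      refine intervalIntegral.integral_congr_ae ?_
      filter_upwards [hf.ae_hasDerivAt, hg.ae_hasDerivAt] with t ht1 ht2 _
      rw [ht1.deriv, ht2.deriv]
    rw [← e, key]
    ring

/-- Integrability of `f'` gives limits at both ends; integrability of `f` forces them to vanish,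
since half-lines have infinite measure. -/
lemma tendsto_integral (hf : IsPrimitive f f') (hf' : Integrable f') (hfi : Integrable f) :
    Filter.Tendsto f Filter.atTop (nhds 0) ∧ Filter.Tendsto f Filter.atBot (nhds 0) := by
  have h1 : Filter.Tendsto f Filter.atTop (nhds (f 0 + ∫ t in Set.Ioi 0, f' t)) := by
    rw [funext hf.eq_add_integral]
    simpa using (intervalIntegral_tendsto_integral_Ioi 0 hf'.integrableOn
      Filter.tendsto_id).const_add (f 0)
  have h2 : Filter.Tendsto f Filter.atBot (nhds (f 0 - ∫ t in Set.Iic 0, f' t)) := by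
    rw [funext hf.eq_add_integral]
    have := (intervalIntegral_tendsto_integral_Iic 0 hf'.integrableOn
      Filter.tendsto_id).const_sub (f 0)
    refine Filter.Tendsto.congr (fun x => ?_) (by simpa using this)
    rw [intervalIntegral.integral_symm x 0, sub_eq_add_neg]
  have e1 : f 0 + ∫ t in Set.Ioi 0, f' t = 0 := by
    refine IntegrableAtFilter.eq_zero_of_tendsto ⟨Set.univ, Filter.univ_mem, hfi.integrableOn⟩
      (fun s hs => ?_) h1
    obtain ⟨b, hb⟩ := Filter.mem_atTop_sets.1 hs
    rw [← top_le_iff, ← Real.volume_Ici (a := b)]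
    exact measure_mono hb
  have e2 : f 0 - ∫ t in Set.Iic 0, f' t = 0 := by
    refine IntegrableAtFilter.eq_zero_of_tendsto ⟨Set.univ, Filter.univ_mem, hfi.integrableOn⟩
      (fun s hs => ?_) h2
    obtain ⟨b, hb⟩ := Filter.mem_atBot_sets.1 hs
    rw [← top_le_iff, ← Real.volume_Iic (a := b)]
    exact measure_mono hb
  rw [e1] at h1
  rw [e2] at h2
  exact ⟨h1, h2⟩

/-- The integral of the derivative of an integrable function vanishes. -/
lemma integral_eq_zero (hf : IsPrimitive f f') (hf' : Integrable f') (hfi : Integrable f) :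
    ∫ x, f' x = 0 := by
  obtain ⟨h1, h2⟩ := hf.tendsto_integral hf' hfi
  have h3 := intervalIntegral_tendsto_integral hf' Filter.tendsto_neg_atTop_atBot
    (Filter.tendsto_id (α := ℝ))
  have h4 : Filter.Tendsto (fun x => f x - f (-x)) Filter.atTop (nhds (0 - 0)) :=
    h1.sub (h2.comp Filter.tendsto_neg_atTop_atBot)
  rw [sub_zero] at h4
  refine tendsto_nhds_unique h3 (h4.congr fun x => ?_)
  rw [hf.eq_add_integral x, hf.eq_add_integral (-x), id,
    ← intervalIntegral.integral_interval_sub_left (hf.intervalIntegrable 0 x)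
      (hf.intervalIntegrable 0 (-x))]
  ring

end IsPrimitive

/-! ### Weak derivatives -/

/-- A test function with vanishing integral is the derivative of a test function. -/
lemma exists_primitive_of_integral_eq_zero {θ : ℝ → ℝ} (hθ : ContDiff ℝ ∞ θ)
    (hc : HasCompactSupport θ) (h0 : ∫ x, θ x = 0) :
    ∃ Φ : ℝ → ℝ, ContDiff ℝ ∞ Φ ∧ HasCompactSupport Φ ∧ deriv Φ = θ := by
  obtain ⟨R, hR⟩ := hc.isCompact.isBounded.subset_closedBall 0
  rw [Real.closedBall_eq_Icc, zero_sub, zero_add] at hR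
  have hz : ∀ x, x ∉ Set.Icc (-R) R → θ x = 0 := fun x hx =>
    image_eq_zero_of_notMem_tsupport fun h => hx (hR h)
  have hd : ∀ x, HasDerivAt (fun x => ∫ t in (-R)..x, θ t) (θ x) x := fun x =>
    (hθ.continuous.integral_hasStrictDerivAt (-R) x).hasDerivAt
  have hd' : deriv (fun x => ∫ t in (-R)..x, θ t) = θ := funext fun x => (hd x).deriv
  refine ⟨fun x => ∫ t in (-R)..x, θ t, ?_, ?_, hd'⟩
  · rw [contDiff_infty_iff_deriv, hd']
    exact ⟨fun x => (hd x).differentiableAt, hθ⟩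
  -- Left of `-R` the integrand vanishes; right of `R` the integral is the total one, which is zero.
  -- The endpoint `-R` is discarded as a null set.
  · refine HasCompactSupport.intro (isCompact_Icc (a := -R) (b := R)) fun x hx => ?_
    by_cases hx1 : x < -R
    · refine (intervalIntegral.integral_congr_ae
        (g := fun _ => (0 : ℝ)) ?_).trans (by simp)
      filter_upwards [Measure.ae_ne volume (-R)] with t ht htm
      rw [Set.uIoc_of_ge hx1.le] at htm
      exact hz t fun h => ht (le_antisymm htm.2 h.1)
    · have hx2 : R < x := by
        by_contra h
        exact hx ⟨not_lt.1 hx1, not_lt.1 h⟩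
      rw [not_lt] at hx1
      rw [intervalIntegral.integral_of_le hx1, ← h0]
      refine setIntegral_eq_integral_of_ae_compl_eq_zero ?_
      filter_upwards [Measure.ae_ne volume (-R)] with t ht htm
      refine hz t fun h => htm ⟨lt_of_le_of_ne h.1 ht.symm, h.2.trans hx2.le⟩

lemma integrable_mul_of_hasCompactSupport {φ w : ℝ → ℝ} (hφ : Continuous φ)
    (hc : HasCompactSupport φ) (hw : LocallyIntegrable w) : Integrable fun x => φ x * w x :=
  hw.integrable_smul_left_of_hasCompactSupport hφ hc

/-- Du Bois-Reymond lemma: a function with vanishing weak derivative is constant. -/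
lemma ae_eq_const_of_weak_deriv_eq_zero {w : ℝ → ℝ} (hw : LocallyIntegrable w)
    (h : ∀ φ : ℝ → ℝ, ContDiff ℝ ∞ φ → HasCompactSupport φ → ∫ x, deriv φ x * w x = 0) :
    ∃ c : ℝ, w =ᵐ[volume] fun _ => c := by
  let B : ContDiffBump (0 : ℝ) := default
  set η : ℝ → ℝ := B.normed volume
  have hη : ContDiff ℝ ∞ η := B.contDiff_normed
  have hηc : HasCompactSupport η := B.hasCompactSupport_normed
  have hη1 : ∫ x, η x = 1 := B.integral_normed
  refine ⟨∫ x, η x * w x, ?_⟩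
  refine ae_eq_of_integral_contDiff_smul_eq hw (locallyIntegrable_const _) fun φ hφ hφc => ?_
  simp only [smul_eq_mul]
  set d := ∫ x, φ x
  have hφi : Integrable φ := hφ.continuous.integrable_of_hasCompactSupport hφc
  have hηi : Integrable η := hη.continuous.integrable_of_hasCompactSupport hηc
  have hθc : HasCompactSupport fun x => φ x - d * η x := by
    have : HasCompactSupport fun x => d * η x := hηc.mul_left
    exact hφc.sub this
  -- Since `η` has integral one, `φ - d η` has integral zero and is some `Φ'`; testing `w` against
  -- it gives `∫ φ w = (∫ φ) (∫ η w)`.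
  obtain ⟨Φ, h1, h2, h3⟩ := exists_primitive_of_integral_eq_zero
    (θ := fun x => φ x - d * η x) (hφ.sub (contDiff_const.mul hη)) hθc (by
      rw [integral_sub hφi (hηi.const_mul d), integral_const_mul, hη1, mul_one, sub_self])
  have h4 := h Φ h1 h2
  rw [h3] at h4
  have e : ∀ x, (φ x - d * η x) * w x = φ x * w x - d * (η x * w x) := fun x => by ring
  simp_rw [e] at h4
  rw [integral_sub (integrable_mul_of_hasCompactSupport hφ.continuous hφc hw)
    ((integrable_mul_of_hasCompactSupport hη.continuous hηc hw).const_mul d),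
    integral_const_mul, sub_eq_zero] at h4
  rw [h4, integral_mul_const]

/-- A function with a locally integrable weak derivative is a primitive of it. -/
lemma exists_isPrimitive_of_weak_deriv {f v : ℝ → ℝ} (hf : LocallyIntegrable f)
    (hv : LocallyIntegrable v)
    (h : ∀ φ : ℝ → ℝ, ContDiff ℝ ∞ φ → HasCompactSupport φ →
      ∫ x, deriv φ x * f x = -∫ x, φ x * v x) :
    ∃ F : ℝ → ℝ, IsPrimitive F v ∧ f =ᵐ[volume] F := by
  have hG := isPrimitive_integral hv 0
  set G : ℝ → ℝ := fun x => 0 + ∫ t in (0 : ℝ)..x, v t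
  have hGl : LocallyIntegrable G := hG.continuous.locallyIntegrable
  obtain ⟨c, hc⟩ := ae_eq_const_of_weak_deriv_eq_zero (w := fun x => f x - G x) (hf.sub hGl) (by
    intro φ hφ hφc
    have hφ' : Continuous (deriv φ) := (hφ.continuous_deriv (by simp))
    have hP : IsPrimitive φ (deriv φ) := .of_hasDerivAt
      (fun x => (hφ.differentiable (by simp) x).hasDerivAt) hφ'
    have i1 := integrable_mul_of_hasCompactSupport hφ' hφc.deriv hGl
    have i2 := integrable_mul_of_hasCompactSupport hφ.continuous hφc hv
    have i3 := integrable_mul_of_hasCompactSupport hφ' hφc.deriv hf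
    have h1 := (hP.mul hG).integral_eq_zero (i1.add i2)
      (integrable_mul_of_hasCompactSupport hφ.continuous hφc hGl)
    rw [integral_add i1 i2] at h1
    simp_rw [mul_sub]
    rw [integral_sub i3 i1, h φ hφ hφc]
    linarith)
  refine ⟨fun x => c + ∫ t in (0 : ℝ)..x, v t, isPrimitive_integral hv c, ?_⟩
  filter_upwards [hc] with x hx
  simp only [G, zero_add] at hx
  linarith

lemma IsWeakDeriv.ae_unique {k : ℕ} {g v w : ℝ → ℂ} (hv : IsWeakDeriv k g v)
    (hw : IsWeakDeriv k g w) : v =ᵐ[volume] w := by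
  refine ae_eq_of_integral_contDiff_smul_eq hv.1 hw.1 fun φ hφ hφc => ?_
  have h := (hv.2 φ hφ hφc).symm.trans (hw.2 φ hφ hφc)
  exact mul_left_cancel₀ (pow_ne_zero _ (neg_ne_zero.2 one_ne_zero)) h

lemma IsWeakDeriv.ae_eq_zero {g v : ℝ → ℂ} (hg : LocallyIntegrable g) (hv : IsWeakDeriv 0 g v) :
    g =ᵐ[volume] v :=
  IsWeakDeriv.ae_unique ⟨hg, fun φ _ _ => by simp⟩ hv

/-- Consecutive weak derivatives. -/
lemma IsWeakDeriv.integral_deriv_smul {k : ℕ} {g v w : ℝ → ℂ} (hv : IsWeakDeriv k g v)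
    (hw : IsWeakDeriv (k + 1) g w) {φ : ℝ → ℝ} (hφ : ContDiff ℝ ∞ φ) (hφc : HasCompactSupport φ) :
    ∫ x, deriv φ x • v x = -∫ x, φ x • w x := by
  have h1 := hv.2 (deriv φ) (contDiff_infty_iff_deriv.1 hφ).2 hφc.deriv
  have h2 := hw.2 φ hφ hφc
  rw [iteratedDeriv_succ'] at h2
  rw [h1, pow_succ, mul_assoc] at h2
  have := mul_left_cancel₀ (pow_ne_zero _ (neg_ne_zero.2 one_ne_zero)) h2
  rw [this]
  ring

lemma locallyIntegrable_clm_comp (ℓ : ℂ →L[ℝ] ℝ) {v : ℝ → ℂ} (hv : LocallyIntegrable v) :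
    LocallyIntegrable fun x => ℓ (v x) :=
  locallyIntegrable_iff.2 fun _ hK => ℓ.integrable_comp (hv.integrableOn_isCompact hK)

/-- Real components of a Sobolev function have absolutely continuous representatives. -/
lemma exists_primitives {n : ℕ} {g : ℝ → ℂ} {v : ℕ → ℝ → ℂ}
    (hv : ∀ k ≤ n, IsWeakDeriv k g (v k)) (ℓ : ℂ →L[ℝ] ℝ) :
    ∃ U : ℕ → ℝ → ℝ, (∀ k ≤ n, (fun x => ℓ (v k x)) =ᵐ[volume] U k) ∧
      ∀ k < n, IsPrimitive (U k) (U (k + 1)) := by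
  -- Each representative is chosen separately, as a primitive of the next component; `congr_deriv`
  -- then replaces that component by its own representative. At the top order the component itself
  -- is kept.
  have hex : ∀ k, ∃ F : ℝ → ℝ, (k ≤ n → (fun x => ℓ (v k x)) =ᵐ[volume] F) ∧
      (k < n → IsPrimitive F (fun x => ℓ (v (k + 1) x))) := by
    intro k
    by_cases hk : k < n
    · have h0 := hv k hk.le
      have h1 := hv (k + 1) hk
      obtain ⟨F, hF, hFe⟩ := exists_isPrimitive_of_weak_deriv
        (locallyIntegrable_clm_comp ℓ h0.1) (locallyIntegrable_clm_comp ℓ h1.1) (by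
          intro φ hφ hφc
          have h2 := congrArg ℓ (h0.integral_deriv_smul h1 hφ hφc)
          rw [map_neg, ← ℓ.integral_comp_comm, ← ℓ.integral_comp_comm] at h2
          · simpa only [map_smul, smul_eq_mul] using h2
          · exact h1.1.integrable_smul_left_of_hasCompactSupport hφ.continuous hφc
          · exact h0.1.integrable_smul_left_of_hasCompactSupport
              (hφ.continuous_deriv (by simp)) hφc.deriv)
      exact ⟨F, fun _ => hFe, fun _ => hF⟩
    · exact ⟨fun x => ℓ (v k x), fun _ => ae_eq_refl _, fun h => absurd h hk⟩
  choose U hU1 hU2 using hex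
  exact ⟨U, hU1, fun k hk => (hU2 k hk).congr_deriv (hU1 (k + 1) hk)⟩

lemma MemSobolev.isWeakDeriv_weakDeriv {n : ℕ} {g : ℝ → ℂ} (hg : MemSobolev n g) {k : ℕ}
    (hk : k ≤ n) : IsWeakDeriv k g (weakDeriv k g) ∧ MemLp (weakDeriv k g) 2 := by
  obtain ⟨v, hv2, hv⟩ := hg.2 k hk
  have H : ∃ v, IsWeakDeriv k g v := ⟨v, hv⟩
  have h1 : IsWeakDeriv k g (weakDeriv k g) := by
    rw [weakDeriv, dif_pos H]
    exact H.choose_spec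
  exact ⟨h1, (memLp_congr_ae (h1.ae_unique hv)).2 hv2⟩

end Kravchuk

namespace Kravchuk

/-! ### Weighted interpolation -/

/-- A bounded regularization of the weight `1 + x²`. -/
noncomputable def weight (ε x : ℝ) : ℝ := (1 + x ^ 2) / (1 + ε * x ^ 2)

/-- The derivative of `weight`. -/
noncomputable def weight' (ε x : ℝ) : ℝ := 2 * x * (1 - ε) / (1 + ε * x ^ 2) ^ 2

section weight

variable {ε : ℝ}

lemma hasDerivAt_weight (hε : 0 < ε) (x : ℝ) : HasDerivAt (weight ε) (weight' ε x) x := by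
  have h1 : HasDerivAt (fun x : ℝ => 1 + x ^ 2) (2 * x) x := by
    simpa using (hasDerivAt_pow 2 x).const_add 1
  have h2 : HasDerivAt (fun x : ℝ => 1 + ε * x ^ 2) (ε * (2 * x)) x := by
    simpa using ((hasDerivAt_pow 2 x).const_mul ε).const_add 1
  have h3 := h1.fun_div h2 (by positivity : 1 + ε * x ^ 2 ≠ 0)
  refine h3.congr_deriv ?_
  rw [weight']
  congr 1
  ring

lemma continuous_weight (hε : 0 < ε) : Continuous (weight ε) :=
  continuous_iff_continuousAt.2 fun x => (hasDerivAt_weight hε x).continuousAt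

lemma continuous_weight' (hε : 0 < ε) : Continuous (weight' ε) := by
  unfold weight'
  exact Continuous.div (by fun_prop) (by fun_prop) fun x => by positivity

lemma one_le_weight (hε : 0 < ε) (hε1 : ε ≤ 1) (x : ℝ) : 1 ≤ weight ε x := by
  rw [weight, one_le_div (by positivity)]
  nlinarith [sq_nonneg x]

lemma weight_le (hε : 0 < ε) (x : ℝ) : weight ε x ≤ 1 + x ^ 2 :=
  div_le_self (by positivity) (by nlinarith [mul_nonneg hε.le (sq_nonneg x)])

lemma weight_le_inv (hε : 0 < ε) (hε1 : ε ≤ 1) (x : ℝ) : weight ε x ≤ ε⁻¹ := by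
  rw [weight, div_le_iff₀ (by positivity), mul_add, ← mul_assoc, inv_mul_cancel₀ hε.ne']
  have := one_le_inv₀ hε |>.2 hε1
  linarith

/-- The constant does not depend on `ε`, which lets the interpolation constant survive the limit `ε
→ 0`. -/
lemma weight'_sq_le (hε : 0 < ε) (hε1 : ε ≤ 1) (x : ℝ) : weight' ε x ^ 2 ≤ 4 * weight ε x := by
  rw [weight, weight', div_pow, mul_div_assoc', div_le_div_iff₀ (by positivity) (by positivity)]
  set d := 1 + ε * x ^ 2 with hd
  have hd1 : 1 ≤ d := by nlinarith [mul_nonneg hε.le (sq_nonneg x)]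
  have h1 : (2 * x * (1 - ε)) ^ 2 ≤ 4 * (1 + x ^ 2) := by
    have h2 : (1 - ε) ^ 2 ≤ 1 := by nlinarith
    nlinarith [mul_le_mul_of_nonneg_left h2 (sq_nonneg x)]
  have h2 : d ≤ (d ^ 2) ^ 2 := by
    rw [← pow_mul]
    exact le_self_pow₀ hd1 (by norm_num)
  exact mul_le_mul h1 h2 (by linarith) (by positivity)

end weight

lemma integrable_bdd_mul_mul {w f g : ℝ → ℝ} (hw : Continuous w) {B : ℝ} (hB : ∀ x, |w x| ≤ B)
    (hf : MemLp f 2) (hg : MemLp g 2) : Integrable fun x => w x * (f x * g x) :=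
  (hf.integrable_mul hg).bdd_mul hw.aestronglyMeasurable (ae_of_all _ hB)

/-- With `a, b, c` for `f, f', f''`, the first two terms are the derivative of `q^(l+1) f f'` and
integrate to zero. The square of `q b + (l + 1) q' a` absorbs the cross term `a b`, thanks to `q'² ≤
4q`, and the square of `q a + η c` absorbs `a c`. -/
lemma weighted_pointwise {q q' η a b c : ℝ} (l : ℕ) (hq : 1 ≤ q) (hq' : q' ^ 2 ≤ 4 * q)
    (hη : 0 < η) :
    0 ≤ ((l + 1 : ℕ) * q ^ l * q') * (a * b) + q ^ (l + 1) * (b * b + a * c)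
      - 1 / 2 * (q ^ (l + 1) * (b * b)) + (2 * (l + 1) ^ 2 + 1 / (2 * η)) * (q ^ (l + 2) * (a * a))
      + η / 2 * (q ^ l * (c * c)) := by
  have hq0 : 0 < q := by linarith
  set L : ℝ := l + 1 with hL
  have h1 : 0 ≤ 1 / 2 * q * b ^ 2 + L * q' * (a * b) + 2 * L ^ 2 * a ^ 2 := by
    refine nonneg_of_mul_nonneg_right ?_ hq0
    nlinarith [sq_nonneg (q * b + L * q' * a), mul_nonneg (sq_nonneg (L * a)) (sub_nonneg.2 hq')]
  have h2 : q * (a * c) + 1 / (2 * η) * (q ^ 2 * a ^ 2) + η / 2 * c ^ 2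
      = 1 / (2 * η) * (q * a + η * c) ^ 2 := by
    field_simp
    ring
  have h2' : 0 ≤ 1 / (2 * η) * (q * a + η * c) ^ 2 := by positivity
  have h3 : 2 * L ^ 2 * a ^ 2 ≤ 2 * L ^ 2 * (q ^ 2 * a ^ 2) := by
    have : 1 ≤ q ^ 2 := one_le_pow₀ hq
    have h4 : a ^ 2 ≤ q ^ 2 * a ^ 2 := le_mul_of_one_le_left (sq_nonneg a) this
    gcongr
  have key : 0 ≤ q ^ l * (L * q' * (a * b) + 1 / 2 * q * b ^ 2 + q * (a * c)
      + (2 * L ^ 2 + 1 / (2 * η)) * (q ^ 2 * a ^ 2) + η / 2 * c ^ 2) :=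
    mul_nonneg (by positivity) (by nlinarith)
  refine key.trans (le_of_eq ?_)
  push_cast
  rw [hL]
  ring

/-- One step of the weighted interpolation inequality. -/
lemma weighted_interpolation_step {ε η : ℝ} (hε : 0 < ε) (hε1 : ε ≤ 1) (hη : 0 < η) (l : ℕ)
    {f₀ f₁ f₂ : ℝ → ℝ} (h01 : IsPrimitive f₀ f₁) (h12 : IsPrimitive f₁ f₂)
    (m0 : MemLp f₀ 2) (m1 : MemLp f₁ 2) (m2 : MemLp f₂ 2) :
    ∫ x, weight ε x ^ (l + 1) * (f₁ x * f₁ x)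
      ≤ η * (∫ x, weight ε x ^ l * (f₂ x * f₂ x))
        + (4 * (l + 1) ^ 2 + 1 / η) * ∫ x, weight ε x ^ (l + 2) * (f₀ x * f₀ x) := by
  have hqc := continuous_weight hε
  have hqc' := continuous_weight' hε
  have hq1 := one_le_weight hε hε1
  have hqε := weight_le_inv hε hε1
  have hpow : ∀ j : ℕ, ∀ x, |weight ε x ^ j| ≤ ε⁻¹ ^ j := fun j x => by
    have := hq1 x
    rw [abs_of_nonneg (by positivity)]
    exact pow_le_pow_left₀ (by linarith) (hqε x) j
  have hint : ∀ j : ℕ, ∀ f g : ℝ → ℝ, MemLp f 2 → MemLp g 2 →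
      Integrable fun x => weight ε x ^ j * (f x * g x) := fun j f g hf hg =>
    integrable_bdd_mul_mul (hqc.pow j) (hpow j) hf hg
  have hqP : IsPrimitive (fun x => weight ε x ^ (l + 1))
      (fun x => (l + 1 : ℕ) * weight ε x ^ l * weight' ε x) :=
    .of_hasDerivAt (fun x => by simpa using (hasDerivAt_weight hε x).fun_pow (l + 1))
      (by fun_prop)
  have hK := hqP.mul (h01.mul h12)
  have hw' : ∀ x, |((l + 1 : ℕ) : ℝ) * weight ε x ^ l * weight' ε x|
      ≤ (l + 1 : ℕ) * ε⁻¹ ^ l * (1 + 4 * ε⁻¹) := fun x => by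
    rw [abs_mul, abs_mul, Nat.abs_cast]
    have h1 : |weight' ε x| ≤ 1 + 4 * ε⁻¹ := by
      have h2 := weight'_sq_le hε hε1 x
      have h3 := hqε x
      have h4 := sq_abs (weight' ε x)
      nlinarith [abs_nonneg (weight' ε x), sq_nonneg (|weight' ε x| - 1)]
    gcongr
    exact hpow l x
  have i1 : Integrable fun x => ((l + 1 : ℕ) : ℝ) * weight ε x ^ l * weight' ε x * (f₀ x * f₁ x) :=
    integrable_bdd_mul_mul (by fun_prop) hw' m0 m1
  have i2 : Integrable fun x => weight ε x ^ (l + 1) * (f₁ x * f₁ x + f₀ x * f₂ x) := by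
    simp_rw [mul_add]
    exact (hint _ _ _ m1 m1).add (hint _ _ _ m0 m2)
  have h0 := hK.integral_eq_zero (i1.add i2) (hint _ _ _ m0 m1)
  have j1 := (hint (l + 1) _ _ m1 m1).const_mul (1 / 2)
  have j0 := (hint (l + 2) _ _ m0 m0).const_mul (2 * ((l : ℝ) + 1) ^ 2 + 1 / (2 * η))
  have j2 := (hint l _ _ m2 m2).const_mul (η / 2)
  have hnn := integral_mono j1 (((i1.fun_add i2).fun_add j0).fun_add j2) fun x => by
    have := weighted_pointwise (a := f₀ x) (b := f₁ x) (c := f₂ x) l (hq1 x)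
      (weight'_sq_le hε hε1 x) hη
    linarith
  rw [integral_add ((i1.fun_add i2).fun_add j0) j2, integral_add (i1.fun_add i2) j0, h0,
    integral_const_mul, integral_const_mul, integral_const_mul] at hnn
  have e : 1 / (2 * η) = 1 / η / 2 := by rw [div_div, mul_comm]
  rw [e] at hnn
  linarith

/-- By induction, `A k ≤ A (k + 1) / (2d) + C A 0` is inserted into the inequality for `A (k + 1)`,
half of which is absorbed on the left. `C` is chosen before `A`, hence is uniform in the
regularization. -/
lemma exists_le_of_three_term (c : ℝ) (hc : 0 ≤ c) (n k : ℕ) (hk : k < n) (η : ℝ) (hη : 0 < η) :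
    ∃ C : ℝ, 0 ≤ C ∧ ∀ A : ℕ → ℝ, (∀ j, 0 ≤ A j) →
      (∀ j, j + 2 ≤ n → ∀ η > 0, A (j + 1) ≤ η * A (j + 2) + (c + 1 / η) * A j) →
      A k ≤ η * A (k + 1) + C * A 0 := by
  induction k generalizing η with
  | zero =>
    refine ⟨1, zero_le_one, fun A hA _ => ?_⟩
    have := mul_nonneg hη.le (hA (0 + 1))
    linarith
  | succ k ih =>
    set d := c + 1 / (η / 2) with hd
    have hd0 : 0 < d := by positivity
    obtain ⟨C, hC, hCA⟩ := ih (by omega) (1 / (2 * d)) (by positivity)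
    refine ⟨2 * d * C, by positivity, fun A hA hrec => ?_⟩
    have h1 := hrec k (by omega) (η / 2) (by positivity)
    have h2 := mul_le_mul_of_nonneg_left (hCA A hA hrec) hd0.le
    have h3 : d * (1 / (2 * d) * A (k + 1) + C * A 0) = A (k + 1) / 2 + d * C * A 0 := by
      field_simp
    rw [h3] at h2
    rw [← hd] at h1
    linarith

/-- The weighted density controlled by the `Σ⁵` norm. -/
noncomputable def sigmaDensity (u : ℕ → ℝ → ℝ) (x : ℝ) : ℝ :=
  ∑ k ∈ Finset.range 5, (1 + x ^ 2) ^ (5 - k) * (u k x * u k x)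

/-- The three term inequality is used with `l = 3 - j ≤ 3`, whence `64 = 4 · 4²`. Chaining `A k ≤ A
(k + 1) + C_k A 0` up to `A 5` and summing over `k`, the constant `C_k` occurs `k` times. -/
lemma exists_regularized_interpolation : ∃ C : ℝ, 0 ≤ C ∧ ∀ u : ℕ → ℝ → ℝ,
    (∀ k < 5, IsPrimitive (u k) (u (k + 1))) → (∀ k ≤ 5, MemLp (u k) 2) →
    ∀ ε : ℝ, 0 < ε → ε ≤ 1 →
      ∑ k ∈ Finset.range 5, ∫ x, weight ε x ^ (5 - k) * (u k x * u k x)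
        ≤ C * ((∫ x, weight ε x ^ 5 * (u 0 x * u 0 x)) + ∫ x, u 5 x * u 5 x) := by
  obtain ⟨C1, p1, h1⟩ := exists_le_of_three_term 64 (by norm_num) 5 1 (by norm_num) 1 one_pos
  obtain ⟨C2, p2, h2⟩ := exists_le_of_three_term 64 (by norm_num) 5 2 (by norm_num) 1 one_pos
  obtain ⟨C3, p3, h3⟩ := exists_le_of_three_term 64 (by norm_num) 5 3 (by norm_num) 1 one_pos
  obtain ⟨C4, p4, h4⟩ := exists_le_of_three_term 64 (by norm_num) 5 4 (by norm_num) 1 one_pos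
  refine ⟨5 + C1 + 2 * C2 + 3 * C3 + 4 * C4, by positivity, fun u hu hL ε hε hε1 => ?_⟩
  set A : ℕ → ℝ := fun k => ∫ x, weight ε x ^ (5 - k) * (u k x * u k x) with hA
  have hA0 : ∀ k, 0 ≤ A k := fun k => integral_nonneg fun x => by
    have := one_le_weight hε hε1 x
    exact mul_nonneg (by positivity) (mul_self_nonneg _)
  have hrec : ∀ j, j + 2 ≤ 5 → ∀ η > 0, A (j + 1) ≤ η * A (j + 2) + (64 + 1 / η) * A j := by
    intro j hj η hη
    have h := weighted_interpolation_step hε hε1 hη (5 - (j + 2)) (hu j (by omega))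
      (hu (j + 1) (by omega)) (hL j (by omega)) (hL (j + 1) (by omega)) (hL (j + 2) (by omega))
    rw [show 5 - (j + 2) + 1 = 5 - (j + 1) by omega, show 5 - (j + 2) + 2 = 5 - j by omega] at h
    refine h.trans ?_
    have hc : 4 * (((5 - (j + 2) : ℕ) : ℝ) + 1) ^ 2 + 1 / η ≤ 64 + 1 / η := by
      have : ((5 - (j + 2) : ℕ) : ℝ) ≤ 3 := by exact_mod_cast (by omega : 5 - (j + 2) ≤ 3)
      have h0 : (0 : ℝ) ≤ ((5 - (j + 2) : ℕ) : ℝ) := by positivity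
      nlinarith
    have := mul_le_mul_of_nonneg_right hc (hA0 j)
    simp only [hA] at this ⊢
    linarith
  have e5 : ∫ x, u 5 x * u 5 x = A 5 := by simp [hA]
  have e0 : ∫ x, weight ε x ^ 5 * (u 0 x * u 0 x) = A 0 := rfl
  rw [e5, e0]
  change ∑ k ∈ Finset.range 5, A k ≤ _
  have g1 := h1 A hA0 hrec
  have g2 := h2 A hA0 hrec
  have g3 := h3 A hA0 hrec
  have g4 := h4 A hA0 hrec
  simp only [Finset.sum_range_succ, Finset.sum_range_zero]
  norm_num at g1 g2 g3 g4 ⊢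
  nlinarith [mul_nonneg p1 (hA0 5), mul_nonneg p2 (hA0 5), mul_nonneg p3 (hA0 5),
    mul_nonneg p4 (hA0 5), hA0 5, hA0 0]

/-- Weighted interpolation: intermediate weighted derivatives are controlled by the extreme
ones. -/
lemma exists_lintegral_sigmaDensity_le : ∃ C : ℝ, 0 ≤ C ∧ ∀ u : ℕ → ℝ → ℝ,
    (∀ k < 5, IsPrimitive (u k) (u (k + 1))) → (∀ k ≤ 5, MemLp (u k) 2) →
    ∫⁻ x, ENNReal.ofReal (sigmaDensity u x) ≤ ENNReal.ofReal C *
      ((∫⁻ x, ENNReal.ofReal ((1 + x ^ 2) ^ 5 * (u 0 x * u 0 x)))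
        + ∫⁻ x, ENNReal.ofReal (u 5 x * u 5 x)) := by
  obtain ⟨C, hC, hb⟩ := exists_regularized_interpolation
  refine ⟨C, hC, fun u hu hL => ?_⟩
  set ε : ℕ → ℝ := fun n => 1 / ((n : ℝ) + 1) with hε
  have hε0 : ∀ n, 0 < ε n := fun n => by positivity
  have hε1 : ∀ n, ε n ≤ 1 := fun n => by
    rw [hε]; exact (div_le_one (by positivity)).2 (by linarith [(Nat.cast_nonneg n : (0 : ℝ) ≤ n)])
  set Ψ : ℕ → ℝ → ℝ := fun n x =>
    ∑ k ∈ Finset.range 5, weight (ε n) x ^ (5 - k) * (u k x * u k x) with hΨ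
  have hcont : ∀ k < 5, Continuous (u k) := fun k hk => (hu k hk).continuous
  have hΨ0 : ∀ n x, 0 ≤ Ψ n x := fun n x => Finset.sum_nonneg fun k _ => by
    have := one_le_weight (hε0 n) (hε1 n) x
    exact mul_nonneg (by positivity) (mul_self_nonneg _)
  have hint : ∀ n, ∀ k ≤ 5, Integrable fun x => weight (ε n) x ^ (5 - k) * (u k x * u k x) :=
    fun n k hk => integrable_bdd_mul_mul (B := (ε n)⁻¹ ^ (5 - k))
      ((continuous_weight (hε0 n)).pow _) (fun x => by
        have := one_le_weight (hε0 n) (hε1 n) x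
        rw [abs_of_nonneg (by positivity)]
        exact pow_le_pow_left₀ (by linarith) (weight_le_inv (hε0 n) (hε1 n) x) _)
      (hL k hk) (hL k hk)
  have hle : ∀ n, ∫⁻ x, ENNReal.ofReal (Ψ n x) ≤ ENNReal.ofReal C *
      ((∫⁻ x, ENNReal.ofReal ((1 + x ^ 2) ^ 5 * (u 0 x * u 0 x)))
        + ∫⁻ x, ENNReal.ofReal (u 5 x * u 5 x)) := by
    intro n
    have i5 : Integrable fun x => u 5 x * u 5 x := by simpa using hint n 5 le_rfl
    have i0 : Integrable fun x => weight (ε n) x ^ 5 * (u 0 x * u 0 x) := hint n 0 (by norm_num)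
    have n0 : ∀ x, 0 ≤ weight (ε n) x ^ 5 * (u 0 x * u 0 x) := fun x => by
      have := one_le_weight (hε0 n) (hε1 n) x
      exact mul_nonneg (by positivity) (mul_self_nonneg _)
    rw [← ofReal_integral_eq_lintegral_ofReal
      (integrable_finsetSum _ fun k hk => hint n k (Finset.mem_range.1 hk).le)
      (ae_of_all _ (hΨ0 n)),
      integral_finsetSum _ fun k hk => hint n k (Finset.mem_range.1 hk).le]
    refine (ENNReal.ofReal_le_ofReal (hb u hu hL (ε n) (hε0 n) (hε1 n))).trans ?_
    rw [ENNReal.ofReal_mul hC, ENNReal.ofReal_add (integral_nonneg n0)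
      (integral_nonneg fun x => mul_self_nonneg _),
      ofReal_integral_eq_lintegral_ofReal i0 (ae_of_all _ n0),
      ofReal_integral_eq_lintegral_ofReal i5 (ae_of_all _ fun x => mul_self_nonneg _)]
    gcongr with x
    · exact mul_self_nonneg _
    · exact (zero_le_one.trans (one_le_weight (hε0 n) (hε1 n) x))
    · exact weight_le (hε0 n) x
  have hεlim : Filter.Tendsto ε Filter.atTop (nhds 0) := tendsto_one_div_add_atTop_nhds_zero_nat
  have hlim : ∀ x, Filter.Tendsto (fun n => ENNReal.ofReal (Ψ n x)) Filter.atTop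
      (nhds (ENNReal.ofReal (sigmaDensity u x))) := by
    intro x
    refine (ENNReal.continuous_ofReal.tendsto _).comp ?_
    refine tendsto_finsetSum _ fun k _ => ?_
    refine Filter.Tendsto.mul_const _ (Filter.Tendsto.pow ?_ _)
    have : Filter.Tendsto (fun n => (1 + x ^ 2) / (1 + ε n * x ^ 2)) Filter.atTop
        (nhds ((1 + x ^ 2) / (1 + 0 * x ^ 2))) :=
      tendsto_const_nhds.div ((hεlim.mul_const _).const_add _) (by simp)
    simpa [weight] using this
  -- Fatou's lemma: finiteness of the mixed weighted terms is not known beforehand, only the uniform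
  -- bound on their regularizations.
  calc ∫⁻ x, ENNReal.ofReal (sigmaDensity u x)
      = ∫⁻ x, Filter.liminf (fun n => ENNReal.ofReal (Ψ n x)) Filter.atTop := by
        congr 1
        funext x
        exact (hlim x).liminf_eq.symm
    _ ≤ Filter.liminf (fun n => ∫⁻ x, ENNReal.ofReal (Ψ n x)) Filter.atTop := by
        refine lintegral_liminf_le fun n => ?_
        refine (Continuous.measurable ?_).ennreal_ofReal
        refine continuous_finsetSum _ fun k hk => ?_
        have := hcont k (Finset.mem_range.1 hk)
        have := continuous_weight (hε0 n)
        fun_prop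
    _ ≤ _ := by
        refine Filter.liminf_le_of_le (by isBoundedDefault) fun b hb => ?_
        obtain ⟨n, hn⟩ := hb.exists
        exact hn.trans (hle n)

end Kravchuk

namespace Kravchuk

/-! ### Consistency of the discrete oscillator -/

lemma abs_sub_le_mul_of_hasDerivAt {f f' : ℝ → ℝ} {c d B : ℝ} (hcd : c ≤ d)
    (hf : ∀ x, HasDerivAt f (f' x) x) (hB : ∀ x ∈ Set.Icc c d, |f' x| ≤ B) :
    |f d - f c| ≤ B * (d - c) :=
  norm_image_sub_le_of_norm_deriv_le_segment' (fun x _ => (hf x).hasDerivWithinAt)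
    (fun x hx => hB x (Set.Ico_subset_Icc_self hx)) d (Set.right_mem_Icc.2 hcd)

/-- The first derivatives of a smooth function on the line. -/
structure IsChain (u : ℕ → ℝ → ℝ) : Prop where
  hasDerivAt : ∀ k < 4, ∀ x, HasDerivAt (u k) (u (k + 1) x) x
  continuous : Continuous (u 4)

namespace IsChain

variable {u : ℕ → ℝ → ℝ}

lemma continuous_of_le (hu : IsChain u) {k : ℕ} (hk : k ≤ 4) : Continuous (u k) := by
  rcases hk.lt_or_eq with hk | rfl
  · exact continuous_iff_continuousAt.2 fun x => (hu.hasDerivAt k hk x).continuousAt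
  · exact hu.continuous

lemma continuous_sigmaDensity (hu : IsChain u) : Continuous (sigmaDensity u) := by
  refine continuous_finsetSum _ fun k hk => ?_
  have := hu.continuous_of_le (Nat.lt_succ_iff.1 (Finset.mem_range.1 hk))
  fun_prop

end IsChain

lemma sigmaDensity_eq (u : ℕ → ℝ → ℝ) (x : ℝ) :
    sigmaDensity u x = (1 + x ^ 2) ^ 5 * u 0 x ^ 2 + (1 + x ^ 2) ^ 4 * u 1 x ^ 2
      + (1 + x ^ 2) ^ 3 * u 2 x ^ 2 + (1 + x ^ 2) ^ 2 * u 3 x ^ 2 + (1 + x ^ 2) * u 4 x ^ 2 := by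
  simp only [sigmaDensity, Finset.sum_range_succ, Finset.sum_range_zero]
  norm_num
  ring

lemma sigmaDensity_nonneg (u : ℕ → ℝ → ℝ) (x : ℝ) : 0 ≤ sigmaDensity u x := by
  rw [sigmaDensity_eq]; positivity

/-! ### Local pointwise bounds by the weighted density -/

section local_bounds

variable {u : ℕ → ℝ → ℝ} {h a b : ℝ}

lemma hasDerivAt_one_add_sq (x : ℝ) : HasDerivAt (fun x : ℝ => 1 + x ^ 2) (2 * x) x := by
  simpa using (hasDerivAt_pow 2 x).const_add 1

/-- Here `66 = 2 · 33`, with `2` from the local Sobolev inequality. The `33 = 1 + 2 · 16` is the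
worst case in `local_bounds`, that of `(1 + x²)² u 0`. -/
lemma abs_le_of_mul_sq_le_integral (hh : 0 < h) (h1 : h ≤ 1) (hb : 0 < b) (hu : IsChain u)
    (hS : 66 * (∫ t in (a - h)..(a + h), sigmaDensity u t) ≤ h * b ^ 2) {f f' : ℝ → ℝ}
    (hf : ∀ x, HasDerivAt f (f' x) x) (hf' : Continuous f')
    (hle : ∀ x, f x ^ 2 + f' x ^ 2 ≤ 33 * sigmaDensity u x) {x : ℝ}
    (hx : x ∈ Set.Icc (a - h) (a + h)) : |f x| ≤ b := by
  have hfc : Continuous f := continuous_iff_continuousAt.2 fun x => (hf x).continuousAt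
  have e1 := mul_sq_le_integral hh h1 hf hf' hx
  have e2 : ∫ t in (a - h)..(a + h), (f t ^ 2 + f' t ^ 2)
      ≤ ∫ t in (a - h)..(a + h), 33 * sigmaDensity u t :=
    intervalIntegral.integral_mono_on (by linarith)
      ((by fun_prop : Continuous fun t => f t ^ 2 + f' t ^ 2).intervalIntegrable _ _)
      ((hu.continuous_sigmaDensity.const_mul 33).intervalIntegrable _ _) fun t _ => hle t
  rw [intervalIntegral.integral_const_mul] at e2
  refine abs_le_of_sq_le_sq ?_ hb.le
  refine le_of_mul_le_mul_left ?_ hh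
  linarith

lemma local_bounds (hh : 0 < h) (h1 : h ≤ 1) (hb : 0 < b) (hu : IsChain u)
    (hS : 66 * (∫ t in (a - h)..(a + h), sigmaDensity u t) ≤ h * b ^ 2) {x : ℝ}
    (hx : x ∈ Set.Icc (a - h) (a + h)) :
    (1 + x ^ 2) ^ 2 * |u 0 x| ≤ b ∧ (1 + x ^ 2) * |u 1 x| ≤ b ∧ (1 + x ^ 2) * |u 2 x| ≤ b := by
  have c0 := hu.continuous_of_le (k := 0) (by norm_num)
  have c1 := hu.continuous_of_le (k := 1) (by norm_num)
  have c2 := hu.continuous_of_le (k := 2) (by norm_num)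
  have c3 := hu.continuous_of_le (k := 3) (by norm_num)
  have d0 := hu.hasDerivAt 0 (by norm_num)
  have d1 := hu.hasDerivAt 1 (by norm_num)
  have d2 := hu.hasDerivAt 2 (by norm_num)
  norm_num at d0 d1 d2
  have hw : ∀ t : ℝ, 1 ≤ 1 + t ^ 2 := fun t => by nlinarith [sq_nonneg t]
  have sq_add : ∀ p q : ℝ, (p + q) ^ 2 ≤ 2 * p ^ 2 + 2 * q ^ 2 := fun p q => by
    nlinarith [sq_nonneg (p - q)]
  refine ⟨?_, ?_, ?_⟩
  · have h2 := abs_le_of_mul_sq_le_integral hh h1 hb hu hS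
      (f := fun x => (1 + x ^ 2) ^ 2 * u 0 x)
      (f' := fun x => 4 * x * (1 + x ^ 2) * u 0 x + (1 + x ^ 2) ^ 2 * u 1 x)
      (fun x => (((hasDerivAt_one_add_sq x).fun_pow 2).mul (d0 x)).congr_deriv (by push_cast; ring))
      (by fun_prop) (fun t => by
        rw [sigmaDensity_eq]
        have e1 := sq_add (4 * t * (1 + t ^ 2) * u 0 t) ((1 + t ^ 2) ^ 2 * u 1 t)
        have hw1 := hw t
        have e2 : (4 * t * (1 + t ^ 2) * u 0 t) ^ 2 ≤ 16 * ((1 + t ^ 2) ^ 3 * u 0 t ^ 2) := by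
          have : t ^ 2 ≤ 1 + t ^ 2 := by linarith
          calc _ = 16 * (t ^ 2 * (1 + t ^ 2) ^ 2 * u 0 t ^ 2) := by ring
            _ ≤ 16 * ((1 + t ^ 2) * (1 + t ^ 2) ^ 2 * u 0 t ^ 2) := by gcongr
            _ = _ := by ring
        generalize 1 + t ^ 2 = w at *
        have e3 : w ^ 3 * u 0 t ^ 2 ≤ w ^ 5 * u 0 t ^ 2 := by gcongr; norm_num
        have e4 : w ^ 4 * u 0 t ^ 2 ≤ w ^ 5 * u 0 t ^ 2 := by gcongr; norm_num
        have p1 : 0 ≤ w ^ 4 * u 1 t ^ 2 := by positivity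
        have p2 : 0 ≤ w ^ 3 * u 2 t ^ 2 := by positivity
        have p3 : 0 ≤ w ^ 2 * u 3 t ^ 2 := by positivity
        have p4 : 0 ≤ w * u 4 t ^ 2 := by positivity
        nlinarith) hx
    rwa [abs_mul, abs_of_nonneg (by positivity)] at h2
  · have h2 := abs_le_of_mul_sq_le_integral hh h1 hb hu hS
      (f := fun x => (1 + x ^ 2) * u 1 x)
      (f' := fun x => 2 * x * u 1 x + (1 + x ^ 2) * u 2 x)
      (fun x => (hasDerivAt_one_add_sq x).mul (d1 x))
      (by fun_prop) (fun t => by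
        rw [sigmaDensity_eq]
        have e1 := sq_add (2 * t * u 1 t) ((1 + t ^ 2) * u 2 t)
        have hw1 := hw t
        have e2 : (2 * t * u 1 t) ^ 2 ≤ 4 * ((1 + t ^ 2) * u 1 t ^ 2) := by
          have : t ^ 2 ≤ 1 + t ^ 2 := by linarith
          calc _ = 4 * (t ^ 2 * u 1 t ^ 2) := by ring
            _ ≤ _ := by gcongr
        generalize 1 + t ^ 2 = w at *
        have e3 : w * u 1 t ^ 2 ≤ w ^ 4 * u 1 t ^ 2 := by
          gcongr; exact le_self_pow₀ hw1 (by norm_num)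
        have e4 : w ^ 2 * u 1 t ^ 2 ≤ w ^ 4 * u 1 t ^ 2 := by gcongr; norm_num
        have e5 : w ^ 2 * u 2 t ^ 2 ≤ w ^ 3 * u 2 t ^ 2 := by gcongr; norm_num
        have p1 : 0 ≤ w ^ 5 * u 0 t ^ 2 := by positivity
        have p2 : 0 ≤ w ^ 3 * u 2 t ^ 2 := by positivity
        have p3 : 0 ≤ w ^ 2 * u 3 t ^ 2 := by positivity
        have p4 : 0 ≤ w * u 4 t ^ 2 := by positivity
        nlinarith) hx
    rwa [abs_mul, abs_of_nonneg (by positivity)] at h2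
  · have h2 := abs_le_of_mul_sq_le_integral hh h1 hb hu hS
      (f := fun x => (1 + x ^ 2) * u 2 x)
      (f' := fun x => 2 * x * u 2 x + (1 + x ^ 2) * u 3 x)
      (fun x => (hasDerivAt_one_add_sq x).mul (d2 x))
      (by fun_prop) (fun t => by
        rw [sigmaDensity_eq]
        have e1 := sq_add (2 * t * u 2 t) ((1 + t ^ 2) * u 3 t)
        have hw1 := hw t
        have e2 : (2 * t * u 2 t) ^ 2 ≤ 4 * ((1 + t ^ 2) * u 2 t ^ 2) := by
          have : t ^ 2 ≤ 1 + t ^ 2 := by linarith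
          calc _ = 4 * (t ^ 2 * u 2 t ^ 2) := by ring
            _ ≤ _ := by gcongr
        generalize 1 + t ^ 2 = w at *
        have e3 : w * u 2 t ^ 2 ≤ w ^ 3 * u 2 t ^ 2 := by
          gcongr; exact le_self_pow₀ hw1 (by norm_num)
        have e4 : w ^ 2 * u 2 t ^ 2 ≤ w ^ 3 * u 2 t ^ 2 := by gcongr; norm_num
        have p1 : 0 ≤ w ^ 5 * u 0 t ^ 2 := by positivity
        have p2 : 0 ≤ w ^ 4 * u 1 t ^ 2 := by positivity
        have p3 : 0 ≤ w ^ 2 * u 3 t ^ 2 := by positivity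
        have p4 : 0 ≤ w * u 4 t ^ 2 := by positivity
        nlinarith) hx
    rwa [abs_mul, abs_of_nonneg (by positivity)] at h2

/-- A supremum bound for `u 4` by the local Sobolev inequality would need `u 5`, which
`sigmaDensity` does not contain. Only the integral of `|u 4|` is used, through `|u 4| ≤ b / 2 + (u
4)² / (2b)`. -/
lemma abs_third_deriv_sub_le (hh : 0 < h) (hb : 0 < b) (hu : IsChain u)
    (hS : 66 * (∫ t in (a - h)..(a + h), sigmaDensity u t) ≤ h * b ^ 2) {t : ℝ}
    (ht : t ∈ Set.Icc 0 h) : |u 3 (a + t) - u 3 (a - t)| ≤ 2 * h * b := by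
  have hi4 : ∀ c d, IntervalIntegrable (u 4) volume c d := fun c d =>
    hu.continuous.intervalIntegrable _ _
  have e1 := intervalIntegral.integral_eq_sub_of_hasDerivAt
    (fun x (_ : x ∈ Set.uIcc (a - t) (a + t)) => hu.hasDerivAt 3 (by norm_num) x)
    (hi4 _ _)
  rw [← e1]
  have c4 := hu.continuous
  have cS := hu.continuous_sigmaDensity
  have hpt : ∀ x, |u 4 x| ≤ b / 2 + 1 / (2 * b) * sigmaDensity u x := by
    intro x
    have h2 : u 4 x ^ 2 ≤ sigmaDensity u x := by
      rw [sigmaDensity_eq]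
      have : u 4 x ^ 2 ≤ (1 + x ^ 2) * u 4 x ^ 2 :=
        le_mul_of_one_le_left (sq_nonneg _) (by nlinarith [sq_nonneg x])
      have p0 : 0 ≤ (1 + x ^ 2) ^ 5 * u 0 x ^ 2 := by positivity
      have p1 : 0 ≤ (1 + x ^ 2) ^ 4 * u 1 x ^ 2 := by positivity
      have p2 : 0 ≤ (1 + x ^ 2) ^ 3 * u 2 x ^ 2 := by positivity
      have p3 : 0 ≤ (1 + x ^ 2) ^ 2 * u 3 x ^ 2 := by positivity
      linarith
    have h3 : b / 2 + 1 / (2 * b) * u 4 x ^ 2 - |u 4 x| = 1 / (2 * b) * (b - |u 4 x|) ^ 2 := by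
      rw [← sq_abs (u 4 x)]
      field_simp
      ring
    have h4 : 0 ≤ 1 / (2 * b) * (b - |u 4 x|) ^ 2 := by positivity
    have h5 : 1 / (2 * b) * u 4 x ^ 2 ≤ 1 / (2 * b) * sigmaDensity u x := by gcongr
    linarith
  have hg : Continuous fun x => b / 2 + 1 / (2 * b) * sigmaDensity u x := by fun_prop
  calc |∫ x in (a - t)..(a + t), u 4 x|
      ≤ ∫ x in (a - t)..(a + t), |u 4 x| :=
        intervalIntegral.abs_integral_le_integral_abs (by linarith [ht.1])
    _ ≤ ∫ x in (a - t)..(a + t), (b / 2 + 1 / (2 * b) * sigmaDensity u x) :=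
        intervalIntegral.integral_mono_on (by linarith [ht.1])
          (c4.abs.intervalIntegrable _ _) (hg.intervalIntegrable _ _) fun x _ => hpt x
    _ ≤ ∫ x in (a - h)..(a + h), (b / 2 + 1 / (2 * b) * sigmaDensity u x) :=
        intervalIntegral.integral_mono_interval (by linarith [ht.2]) (by linarith [ht.1])
          (by linarith [ht.2]) (ae_of_all _ fun x => by
            have := sigmaDensity_nonneg u x
            simp only [Pi.zero_apply]
            positivity) (hg.intervalIntegrable _ _)
    _ = h * b + 1 / (2 * b) * ∫ x in (a - h)..(a + h), sigmaDensity u x := by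
        rw [intervalIntegral.integral_add (by simp) ((cS.const_mul _).intervalIntegrable _ _),
          intervalIntegral.integral_const_mul, intervalIntegral.integral_const, smul_eq_mul]
        ring
    _ ≤ h * b + 1 / (2 * b) * (h * b ^ 2) := by
        have hS0 : 0 ≤ ∫ t in (a - h)..(a + h), sigmaDensity u t :=
          intervalIntegral.integral_nonneg (by linarith) fun x _ => sigmaDensity_nonneg u x
        gcongr
        linarith
    _ ≤ 2 * h * b := by
        have : 1 / (2 * b) * (h * b ^ 2) = h * b / 2 := by field_simp
        rw [this]
        have := mul_pos hh hb
        linarith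

/-- The symmetric combination cancels the odd orders. Starting from the difference of `u 3` at `a ±
t`, three applications of the mean value inequality on `[0, h]` gain one factor `h` each. -/
lemma abs_taylor_remainder_le (hh : 0 < h) (hb : 0 < b) (hu : IsChain u)
    (hS : 66 * (∫ t in (a - h)..(a + h), sigmaDensity u t) ≤ h * b ^ 2) :
    |u 0 (a + h) + u 0 (a - h) - 2 * u 0 a - h ^ 2 * u 2 a| ≤ 2 * h ^ 4 * b := by
  have d0 := hu.hasDerivAt 0 (by norm_num)
  have d1 := hu.hasDerivAt 1 (by norm_num)
  have d2 := hu.hasDerivAt 2 (by norm_num)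
  norm_num at d0 d1 d2
  have p0 : ∀ t, HasDerivAt (fun t => u 0 (a + t)) (u 1 (a + t)) t := fun t =>
    (d0 (a + t)).comp_const_add a t
  have m0 : ∀ t, HasDerivAt (fun t => u 0 (a - t)) (-u 1 (a - t)) t := fun t =>
    (d0 (a - t)).comp_const_sub a t
  have p1 : ∀ t, HasDerivAt (fun t => u 1 (a + t)) (u 2 (a + t)) t := fun t =>
    (d1 (a + t)).comp_const_add a t
  have m1 : ∀ t, HasDerivAt (fun t => u 1 (a - t)) (-u 2 (a - t)) t := fun t =>
    (d1 (a - t)).comp_const_sub a t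
  have p2 : ∀ t, HasDerivAt (fun t => u 2 (a + t)) (u 3 (a + t)) t := fun t =>
    (d2 (a + t)).comp_const_add a t
  have m2 : ∀ t, HasDerivAt (fun t => u 2 (a - t)) (-u 3 (a - t)) t := fun t =>
    (d2 (a - t)).comp_const_sub a t
  have r2 : ∀ t ∈ Set.Icc 0 h, |u 2 (a + t) + u 2 (a - t) - 2 * u 2 a| ≤ 2 * h * b * h := by
    intro t ht
    have := abs_sub_le_mul_of_hasDerivAt (f := fun t => u 2 (a + t) + u 2 (a - t)) ht.1
      (fun t => (p2 t).fun_add (m2 t)) (B := 2 * h * b) (fun s hs => by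
        rw [← sub_eq_add_neg]
        exact abs_third_deriv_sub_le hh hb hu hS ⟨hs.1, hs.2.trans ht.2⟩)
    rw [add_zero, sub_zero, ← two_mul, sub_zero] at this
    refine this.trans ?_
    gcongr
    exact ht.2
  have r1 : ∀ t ∈ Set.Icc 0 h, |u 1 (a + t) - u 1 (a - t) - 2 * t * u 2 a|
      ≤ 2 * h * b * h * h := by
    intro t ht
    have := abs_sub_le_mul_of_hasDerivAt
      (f := fun t => u 1 (a + t) - u 1 (a - t) - 2 * t * u 2 a)
      (f' := fun t => u 2 (a + t) + u 2 (a - t) - 2 * u 2 a) ht.1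
      (fun t => (((p1 t).fun_sub (m1 t)).fun_sub
        (((hasDerivAt_id t).const_mul 2).mul_const (u 2 a))).congr_deriv (by ring))
      (B := 2 * h * b * h) (fun s hs => r2 s ⟨hs.1, hs.2.trans ht.2⟩)
    simp only [add_zero, sub_zero, sub_self, mul_zero, zero_mul] at this
    refine this.trans ?_
    gcongr
    exact ht.2
  have := abs_sub_le_mul_of_hasDerivAt
    (f := fun t => u 0 (a + t) + u 0 (a - t) - 2 * u 0 a - t ^ 2 * u 2 a)
    (f' := fun t => u 1 (a + t) - u 1 (a - t) - 2 * t * u 2 a) hh.le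
    (fun t => ((((p0 t).fun_add (m0 t)).sub_const (2 * u 0 a)).fun_sub
      ((hasDerivAt_pow 2 t).mul_const (u 2 a))).congr_deriv (by simp; ring))
    (B := 2 * h * b * h * h) (fun s hs => r1 s hs)
  have e : u 0 (a + 0) + u 0 (a - 0) - 2 * u 0 a - 0 ^ 2 * u 2 a = 0 := by
    rw [add_zero, sub_zero]; ring
  rw [e, sub_zero, sub_zero] at this
  refine this.trans (le_of_eq (by ring))

end local_bounds

/-- With `s = √(1 + t)` the left side is `(s - 1)² / 2`, and `t = (s - 1) (s + 1)` with `s + 1 ≥ 1`.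
No smallness of `t` is needed, so the expansion holds up to the edge of `A_h`. -/
lemma abs_sqrt_one_add_sub_le {t : ℝ} (ht : -1 ≤ t) : |√(1 + t) - 1 - t / 2| ≤ t ^ 2 / 2 := by
  set s := √(1 + t) with hs
  have hs0 : 0 ≤ s := Real.sqrt_nonneg _
  have hs2 : s ^ 2 = 1 + t := Real.sq_sqrt (by linarith)
  have ht' : t = (s - 1) * (s + 1) := by linarith
  have e : s - 1 - t / 2 = -((s - 1) ^ 2 / 2) := by rw [ht']; ring
  rw [e, abs_neg, abs_of_nonneg (by positivity), ht', mul_pow]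
  have : 1 ≤ (s + 1) ^ 2 := one_le_pow₀ (by linarith)
  nlinarith [sq_nonneg (s - 1)]

/-- The consistency error of the discrete oscillator at the point `a`. -/
noncomputable def oscillatorError (h : ℝ) (u : ℕ → ℝ → ℝ) (a : ℝ) : ℝ :=
  -u 2 a + a ^ 2 * u 0 a -
    if |a| ≤ 1 / h then
      -(1 / h ^ 2 * √((1 + a * h + h ^ 2) * (1 - a * h))) * u 0 (a + h)
        - (1 / h ^ 2 * √((1 - a * h + h ^ 2) * (1 + a * h))) * u 0 (a - h)
        + (1 + 2 / h ^ 2) * u 0 a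
    else 0

lemma one_add_sq_le_of_mem {a h x : ℝ} (h1 : h ≤ 1) (hx : x ∈ Set.Icc (a - h) (a + h)) :
    1 + a ^ 2 ≤ 3 * (1 + x ^ 2) := by
  have h2 : (a - x) ^ 2 ≤ 1 := by
    rw [sq_le_one_iff_abs_le_one, abs_le]
    constructor <;> linarith [hx.1, hx.2]
  nlinarith [sq_nonneg (a - 2 * x)]

lemma abs_le_one_add_sq (a : ℝ) : |a| ≤ 1 + a ^ 2 := by
  rw [← sq_abs a]
  nlinarith [sq_nonneg (|a| - 1), abs_nonneg a]

lemma abs_one_sub_sq_le (a : ℝ) : |1 - a ^ 2| ≤ 1 + a ^ 2 := by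
  rw [abs_le]
  constructor <;> linarith [sq_nonneg a]

/-- Expansion of the coefficients of the discrete oscillator. -/
lemma exists_sqrt_coeff_eq {a h s : ℝ} (hs : s ^ 2 = 1) (h1 : |a * h| ≤ 1) :
    ∃ E : ℝ, |E| ≤ 2 * h ^ 4 * (1 + a ^ 2) ^ 2 ∧
      √((1 + s * (a * h) + h ^ 2) * (1 - s * (a * h)))
        = 1 + (h ^ 2 * (1 - a ^ 2) - s * (a * h) * h ^ 2) / 2 + E := by
  set y := s * (a * h) with hy
  have hs1 : |s| = 1 := by
    rw [← Real.sqrt_sq_eq_abs, hs, Real.sqrt_one]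
  have hyabs : |y| ≤ 1 := by rw [hy, abs_mul, hs1, one_mul]; exact h1
  have hy2 : y ^ 2 = a ^ 2 * h ^ 2 := by rw [hy, mul_pow, hs, one_mul, mul_pow]
  obtain ⟨hl, hr⟩ := abs_le.1 hyabs
  set t := h ^ 2 * (1 - a ^ 2) - y * h ^ 2 with ht
  have et : (1 + y + h ^ 2) * (1 - y) = 1 + t := by
    rw [ht]
    linear_combination -hy2
  have ht1 : -1 ≤ t := by
    have : 0 ≤ (1 + y + h ^ 2) * (1 - y) :=
      mul_nonneg (by linarith [sq_nonneg h]) (by linarith)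
    linarith
  have habs : |t| ≤ 2 * (h ^ 2 * (1 + a ^ 2)) := by
    refine (abs_sub _ _).trans ?_
    rw [abs_mul, abs_mul, abs_of_nonneg (sq_nonneg h)]
    have e1 := mul_le_mul_of_nonneg_left (abs_one_sub_sq_le a) (sq_nonneg h)
    have e2 := mul_le_mul_of_nonneg_right
      (hyabs.trans (by linarith [sq_nonneg a] : (1 : ℝ) ≤ 1 + a ^ 2)) (sq_nonneg h)
    linarith
  refine ⟨√(1 + t) - 1 - t / 2, (abs_sqrt_one_add_sub_le ht1).trans ?_, by rw [et]; ring⟩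
  have := pow_le_pow_left₀ (abs_nonneg t) habs 2
  rw [sq_abs] at this
  linarith

/-- Bounds of the first and second difference. -/
lemma difference_bounds {u : ℕ → ℝ → ℝ} {h a B : ℝ} (hh : 0 < h) (hB : 0 ≤ B) (hu : IsChain u)
    (hu1 : ∀ x ∈ Set.Icc (a - h) (a + h), |u 1 x| ≤ B)
    (hu2 : ∀ x ∈ Set.Icc (a - h) (a + h), |u 2 x| ≤ B) :
    |u 0 (a + h) - u 0 (a - h)| ≤ B * (2 * h) ∧
      |u 0 (a + h) + u 0 (a - h) - 2 * u 0 a| ≤ B * (2 * h) * h := by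
  have d0 := hu.hasDerivAt 0 (by norm_num)
  have d1 := hu.hasDerivAt 1 (by norm_num)
  norm_num at d0 d1
  constructor
  · have := abs_sub_le_mul_of_hasDerivAt (by linarith) d0 hu1
    rwa [show a + h - (a - h) = 2 * h by ring] at this
  · have := abs_sub_le_mul_of_hasDerivAt (f := fun t => u 0 (a + t) + u 0 (a - t))
      (f' := fun t => u 1 (a + t) - u 1 (a - t)) hh.le
      (fun t => (((d0 (a + t)).comp_const_add a t).add
        ((d0 (a - t)).comp_const_sub a t)).congr_deriv (by ring))
      (B := B * (2 * h)) (fun t ht => by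
        have e1 := abs_sub_le_mul_of_hasDerivAt (c := a - t) (d := a + t)
          (by linarith [ht.1]) d1
          (fun x hx => hu2 x ⟨by linarith [hx.1, ht.2], by linarith [hx.2, ht.2]⟩)
        refine e1.trans ?_
        have : a + t - (a - t) ≤ 2 * h := by linarith [ht.2]
        gcongr)
    rwa [add_zero, sub_zero, ← two_mul, sub_zero] at this

lemma abs_oscillatorError_le_of_mem {u : ℕ → ℝ → ℝ} {h a b : ℝ} (hh : 0 < h) (h1 : h ≤ 1)
    (hb : 0 < b) (hu : IsChain u)
    (hS : 66 * (∫ t in (a - h)..(a + h), sigmaDensity u t) ≤ h * b ^ 2) (hah : |a| ≤ 1 / h) :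
    |oscillatorError h u a| ≤ 44 * h ^ 2 * b := by
  have hloc := fun x hx => local_bounds (x := x) hh h1 hb hu hS hx
  have hR := abs_taylor_remainder_le hh hb hu hS
  have hap : a + h ∈ Set.Icc (a - h) (a + h) := ⟨by linarith, by linarith⟩
  have ham : a - h ∈ Set.Icc (a - h) (a + h) := ⟨by linarith, by linarith⟩
  have hw0 : 0 < 1 + a ^ 2 := by positivity
  have hah' : |a * h| ≤ 1 := by
    rw [abs_mul, abs_of_pos hh]
    rwa [le_div_iff₀ hh] at hah
  have hu0 : ∀ x ∈ Set.Icc (a - h) (a + h), (1 + a ^ 2) ^ 2 * |u 0 x| ≤ 9 * b := by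
    intro x hx
    have e1 := one_add_sq_le_of_mem h1 hx
    calc (1 + a ^ 2) ^ 2 * |u 0 x| ≤ (3 * (1 + x ^ 2)) ^ 2 * |u 0 x| := by gcongr
      _ = 9 * ((1 + x ^ 2) ^ 2 * |u 0 x|) := by ring
      _ ≤ 9 * b := by linarith [(hloc x hx).1]
  obtain ⟨hD1, hD2⟩ := difference_bounds (a := a) (B := 3 * b / (1 + a ^ 2)) hh (by positivity) hu
    (fun x hx => by
      rw [le_div_iff₀ hw0]
      have e1 := mul_le_mul_of_nonneg_right (one_add_sq_le_of_mem h1 hx) (abs_nonneg (u 1 x))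
      linarith [(hloc x hx).2.1])
    (fun x hx => by
      rw [le_div_iff₀ hw0]
      have e1 := mul_le_mul_of_nonneg_right (one_add_sq_le_of_mem h1 hx) (abs_nonneg (u 2 x))
      linarith [(hloc x hx).2.2])
  obtain ⟨Ep, bp, sp⟩ := exists_sqrt_coeff_eq (s := 1) (by norm_num) hah'
  obtain ⟨Em, bm, sm⟩ := exists_sqrt_coeff_eq (s := -1) (by norm_num) hah'
  rw [one_mul] at sp
  rw [neg_one_mul, sub_neg_eq_add, ← sub_eq_add_neg] at sm
  rw [oscillatorError, if_pos hah, sp, sm]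
  have hup := hu0 _ hap
  have hum := hu0 _ ham
  clear hloc hu0 hS sp sm hap ham
  generalize u 0 (a + h) = up at *
  generalize u 0 (a - h) = um at *
  generalize u 0 a = u0 at *
  generalize u 2 a = u2 at *
  have hh2 : 0 < h ^ 2 := by positivity
  -- The zeroth order terms in `u0` cancel, since `(1 - a²) + a²` is the constant `1` of the
  -- diagonal coefficient. The remaining errors have constants `2`, `3`, `3` and `18 + 18`, in total
  -- `44`.
  have main : -u2 + a ^ 2 * u0
      - (-(1 / h ^ 2 * (1 + (h ^ 2 * (1 - a ^ 2) - a * h * h ^ 2) / 2 + Ep)) * up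
        - 1 / h ^ 2 * (1 + (h ^ 2 * (1 - a ^ 2) - -(a * h) * h ^ 2) / 2 + Em) * um
        + (1 + 2 / h ^ 2) * u0)
      = (up + um - 2 * u0 - h ^ 2 * u2) / h ^ 2 + (1 - a ^ 2) / 2 * (up + um - 2 * u0)
        - a * h / 2 * (up - um) + (Ep * up / h ^ 2 + Em * um / h ^ 2) := by
    field_simp
    ring
  rw [main]
  have t1 : |(up + um - 2 * u0 - h ^ 2 * u2) / h ^ 2| ≤ 2 * h ^ 2 * b := by
    rw [abs_div, abs_of_pos hh2, div_le_iff₀ hh2]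
    linarith
  have t2 : |(1 - a ^ 2) / 2 * (up + um - 2 * u0)| ≤ 3 * h ^ 2 * b := by
    rw [abs_mul, abs_div, abs_of_pos (by norm_num : (0 : ℝ) < 2)]
    calc _ ≤ (1 + a ^ 2) / 2 * (3 * b / (1 + a ^ 2) * (2 * h) * h) := by
          gcongr
          exact abs_one_sub_sq_le a
      _ = 3 * h ^ 2 * b := by field_simp
  have t3 : |a * h / 2 * (up - um)| ≤ 3 * h ^ 2 * b := by
    rw [abs_mul, abs_div, abs_mul, abs_of_pos hh, abs_of_pos (by norm_num : (0 : ℝ) < 2)]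
    calc _ ≤ (1 + a ^ 2) * h / 2 * (3 * b / (1 + a ^ 2) * (2 * h)) := by
          gcongr
          exact abs_le_one_add_sq a
      _ = 3 * h ^ 2 * b := by field_simp
  have t4 : ∀ E v : ℝ, |E| ≤ 2 * h ^ 4 * (1 + a ^ 2) ^ 2 → (1 + a ^ 2) ^ 2 * |v| ≤ 9 * b →
      |E * v / h ^ 2| ≤ 18 * h ^ 2 * b := by
    intro E v hE hv
    rw [abs_div, abs_mul, abs_of_pos hh2, div_le_iff₀ hh2]
    calc |E| * |v| ≤ 2 * h ^ 4 * (1 + a ^ 2) ^ 2 * |v| := by gcongr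
      _ = 2 * h ^ 4 * ((1 + a ^ 2) ^ 2 * |v|) := by ring
      _ ≤ 2 * h ^ 4 * (9 * b) := by gcongr
      _ = _ := by ring
  have t4p := t4 Ep up bp hup
  have t4m := t4 Em um bm hum
  refine (abs_add_le _ _).trans ?_
  have s1 := abs_add_le (Ep * up / h ^ 2) (Em * um / h ^ 2)
  have s2 := abs_sub ((up + um - 2 * u0 - h ^ 2 * u2) / h ^ 2
    + (1 - a ^ 2) / 2 * (up + um - 2 * u0)) (a * h / 2 * (up - um))
  have s3 := abs_add_le ((up + um - 2 * u0 - h ^ 2 * u2) / h ^ 2)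
    ((1 - a ^ 2) / 2 * (up + um - 2 * u0))
  linarith

/-- Outside `A_h` only `-u 2 a + a² u 0 a` remains, and `1 < h² a²` trades a spare weight `a²` for
the factor `h²`. -/
lemma abs_oscillatorError_le {u : ℕ → ℝ → ℝ} {h a b : ℝ} (hh : 0 < h) (h1 : h ≤ 1) (hb : 0 < b)
    (hu : IsChain u) (hS : 66 * (∫ t in (a - h)..(a + h), sigmaDensity u t) ≤ h * b ^ 2) :
    |oscillatorError h u a| ≤ 44 * h ^ 2 * b := by
  by_cases hah : |a| ≤ 1 / h
  · exact abs_oscillatorError_le_of_mem hh h1 hb hu hS hah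
  · obtain ⟨b0, -, b2⟩ := local_bounds (x := a) hh h1 hb hu hS ⟨by linarith, by linarith⟩
    rw [oscillatorError, if_neg hah, sub_zero]
    have hah' : 1 < h ^ 2 * a ^ 2 := by
      rw [not_le, div_lt_iff₀ hh] at hah
      have : 1 < (|a| * h) ^ 2 := one_lt_pow₀ hah (by norm_num)
      rw [mul_pow, sq_abs] at this
      linarith
    have hle : a ^ 2 ≤ 1 + a ^ 2 := by linarith
    have e1 : |u 2 a| ≤ h ^ 2 * b := by
      calc |u 2 a| ≤ h ^ 2 * a ^ 2 * |u 2 a| := le_mul_of_one_le_left (abs_nonneg _) hah'.le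
        _ = h ^ 2 * (a ^ 2 * |u 2 a|) := by ring
        _ ≤ h ^ 2 * ((1 + a ^ 2) * |u 2 a|) := by gcongr
        _ ≤ h ^ 2 * b := by gcongr
    have e2 : |a ^ 2 * u 0 a| ≤ h ^ 2 * b := by
      rw [abs_mul, abs_of_nonneg (sq_nonneg a)]
      calc a ^ 2 * |u 0 a| ≤ h ^ 2 * a ^ 2 * (a ^ 2 * |u 0 a|) :=
            le_mul_of_one_le_left (by positivity) hah'.le
        _ = h ^ 2 * ((a ^ 2) ^ 2 * |u 0 a|) := by ring
        _ ≤ h ^ 2 * ((1 + a ^ 2) ^ 2 * |u 0 a|) := by gcongr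
        _ ≤ h ^ 2 * b := by gcongr
    refine (abs_add_le _ _).trans ?_
    rw [abs_neg]
    have : 0 ≤ h ^ 2 * b := by positivity
    linarith

/-- Local consistency estimate. -/
lemma mul_oscillatorError_sq_le {u : ℕ → ℝ → ℝ} {h : ℝ} (a : ℝ) (hh : 0 < h) (h1 : h ≤ 1)
    (hu : IsChain u) :
    h * oscillatorError h u a ^ 2
      ≤ 44 ^ 2 * 66 * h ^ 4 * ∫ t in (a - h)..(a + h), sigmaDensity u t := by
  set S := ∫ t in (a - h)..(a + h), sigmaDensity u t with hSdef
  have hS0 : 0 ≤ S :=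
    intervalIntegral.integral_nonneg (by linarith) fun x _ => sigmaDensity_nonneg u x
  -- The pointwise bound requires `b > 0`, but the local integral may vanish. Hence `b` is chosen
  -- with `h b²` slightly larger than `66 S`.
  refine le_of_forall_pos_le_add fun η hη => ?_
  set d := 66 * S + η / (44 ^ 2 * h ^ 4) with hd
  have hd0 : 0 < d := by positivity
  have hb2 : h * √(d / h) ^ 2 = d := by rw [Real.sq_sqrt (by positivity)]; field_simp
  have key := abs_oscillatorError_le (a := a) (b := √(d / h)) hh h1 (by positivity) hu (by
    rw [hb2, ← hSdef, hd]
    have : 0 < η / (44 ^ 2 * h ^ 4) := by positivity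
    linarith)
  calc h * oscillatorError h u a ^ 2 ≤ h * (44 * h ^ 2 * √(d / h)) ^ 2 := by
        rw [← sq_abs]; gcongr
    _ = 44 ^ 2 * h ^ 4 * (h * √(d / h) ^ 2) := by ring
    _ = _ := by
        rw [hb2, hd]
        field_simp

/-- Consistency of the discrete oscillator in `ℓ²`. -/
lemma tsum_oscillatorError_le {u : ℕ → ℝ → ℝ} {h : ℝ} (hh : 0 < h) (h1 : h ≤ 1)
    (hu : IsChain u) :
    ∑' k : ℤ, ENNReal.ofReal (h * oscillatorError h u (k * h) ^ 2)
      ≤ ENNReal.ofReal (2 * (44 ^ 2 * 66 * h ^ 4)) *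
        ∫⁻ x, ENNReal.ofReal (sigmaDensity u x) :=
  tsum_ofReal_le hh hu.continuous_sigmaDensity (sigmaDensity_nonneg u) (by positivity)
    fun k => mul_oscillatorError_sq_le (k * h) hh h1 hu

end Kravchuk

namespace Kravchuk

/-! ### Consistency in `Σ⁵` -/

lemma eLpNorm_two_sq (f : ℝ → ℂ) : eLpNorm f 2 ^ 2 = ∫⁻ x, ‖f x‖ₑ ^ 2 := by
  have := eLpNorm_nnreal_pow_eq_lintegral (f := f) (μ := volume) (p := 2) (by norm_num)
  simpa using this

lemma enorm_sq_eq (z : ℂ) :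
    ‖z‖ₑ ^ 2 = ENNReal.ofReal (z.re * z.re) + ENNReal.ofReal (z.im * z.im) := by
  rw [← ofReal_norm, ← ENNReal.ofReal_pow (norm_nonneg _), Complex.sq_norm, Complex.normSq_apply,
    ENNReal.ofReal_add (mul_self_nonneg _) (mul_self_nonneg _)]

/-- Smooth real and imaginary parts of a function in `Σ⁵`. -/
lemma MemSigma.exists_chains {g : ℝ → ℂ} (hg : MemSigma 5 g) :
    ∃ U V : ℕ → ℝ → ℝ,
      (∀ k ≤ 5, weakDeriv k g =ᵐ[volume] fun x => (U k x : ℂ) + V k x * Complex.I) ∧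
      (∀ k < 5, IsPrimitive (U k) (U (k + 1))) ∧ (∀ k < 5, IsPrimitive (V k) (V (k + 1))) ∧
      (∀ k ≤ 5, MemLp (U k) 2) ∧ ∀ k ≤ 5, MemLp (V k) 2 := by
  have hw := fun k (hk : k ≤ 5) => hg.1.isWeakDeriv_weakDeriv hk
  obtain ⟨U, hU, hU'⟩ := exists_primitives (fun k hk => (hw k hk).1) Complex.reCLM
  obtain ⟨V, hV, hV'⟩ := exists_primitives (fun k hk => (hw k hk).1) Complex.imCLM
  refine ⟨U, V, fun k hk => ?_, hU', hV', fun k hk => ?_, fun k hk => ?_⟩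
  · filter_upwards [hU k hk, hV k hk] with x h1 h2
    rw [← h1, ← h2]
    exact (Complex.re_add_im _).symm
  · exact (memLp_congr_ae (hU k hk)).1 (Complex.reCLM.comp_memLp' (hw k hk).2)
  · exact (memLp_congr_ae (hV k hk)).1 (Complex.imCLM.comp_memLp' (hw k hk).2)

lemma isChain_of_isPrimitive {U : ℕ → ℝ → ℝ} (hU : ∀ k < 5, IsPrimitive (U k) (U (k + 1))) :
    IsChain U :=
  ⟨fun k hk => (hU k (by omega)).hasDerivAt (hU (k + 1) (by omega)).continuous,
    (hU 4 (by norm_num)).continuous⟩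

/-! ### Passage between the complex function and its real and imaginary parts -/

section

variable {g : ℝ → ℂ} {U V : ℕ → ℝ → ℝ}

/-- Both operators have real coefficients, so the error splits once all functions are replaced by
their continuous representatives. -/
lemma error_eq (hgU : g =ᵐ[volume] fun x => (U 0 x : ℂ) + V 0 x * Complex.I)
    (hgU2 : weakDeriv 2 g =ᵐ[volume] fun x => (U 2 x : ℂ) + V 2 x * Complex.I)
    (hU : IsChain U) (hV : IsChain V) (h : ℝ) (a : Grid h) :
    (gridProj h (harmonicOscillator g) - discreteOscillator h (gridProj h g)) a
      = (oscillatorError h U a : ℂ) + oscillatorError h V a * Complex.I := by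
  have cU0 := hU.continuous_of_le (k := 0) (by norm_num)
  have cV0 := hV.continuous_of_le (k := 0) (by norm_num)
  have cU2 := hU.continuous_of_le (k := 2) (by norm_num)
  have cV2 := hV.continuous_of_le (k := 2) (by norm_num)
  have e0 : contRep g = fun x => (U 0 x : ℂ) + V 0 x * Complex.I :=
    contRep_eq (by fun_prop) hgU
  have e1 : contRep (harmonicOscillator g) = fun x => -((U 2 x : ℂ) + V 2 x * Complex.I)
      + (x : ℂ) ^ 2 * ((U 0 x : ℂ) + V 0 x * Complex.I) := by
    refine contRep_eq (by fun_prop) ?_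
    filter_upwards [hgU, hgU2] with x h1 h2
    rw [harmonicOscillator, h1, h2]
  rw [Pi.sub_apply, gridProj, e1, discreteOscillator]
  simp only [gridProj, e0, oscillatorError, AddSubgroup.coe_add, AddSubgroup.coe_sub, coe_step]
  split_ifs with ha
  · push_cast
    ring
  · push_cast
    ring

lemma sq_eLpNorm_weight (hgU : g =ᵐ[volume] fun x => (U 0 x : ℂ) + V 0 x * Complex.I)
    (hU : Continuous (U 0)) :
    (∫⁻ x, ENNReal.ofReal ((1 + x ^ 2) ^ 5 * (U 0 x * U 0 x)))
      + (∫⁻ x, ENNReal.ofReal ((1 + x ^ 2) ^ 5 * (V 0 x * V 0 x)))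
      = eLpNorm (fun x => japanese x ^ 5 • g x) 2 ^ 2 := by
  rw [eLpNorm_two_sq, ← lintegral_add_left (by fun_prop)]
  refine lintegral_congr_ae ?_
  filter_upwards [hgU] with x hx
  have hj : (japanese x ^ 5) * (japanese x ^ 5) = (1 + x ^ 2) ^ 5 := by
    rw [← mul_pow, japanese, Real.mul_self_sqrt (by positivity)]
  rw [enorm_sq_eq, hx, ← hj]
  generalize japanese x ^ 5 = j
  rw [Complex.real_smul]
  congr 2 <;> simp <;> ring

lemma sq_eLpNorm_weakDeriv
    (hgU : weakDeriv 5 g =ᵐ[volume] fun x => (U 5 x : ℂ) + V 5 x * Complex.I)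
    (hU : MemLp (U 5) 2) :
    (∫⁻ x, ENNReal.ofReal (U 5 x * U 5 x)) + (∫⁻ x, ENNReal.ofReal (V 5 x * V 5 x))
      = eLpNorm (weakDeriv 5 g) 2 ^ 2 := by
  have hm := hU.1.aemeasurable
  rw [eLpNorm_two_sq, ← lintegral_add_left' (hm.fun_mul hm).ennreal_ofReal]
  refine lintegral_congr_ae ?_
  filter_upwards [hgU] with x hx
  rw [enorm_sq_eq, hx]
  simp

end

lemma eLpNorm_weakDeriv_le_sobolevNorm (n : ℕ) (g : ℝ → ℂ) :
    eLpNorm (weakDeriv n g) 2 ≤ sobolevNorm n g := by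
  have h1 : eLpNorm (weakDeriv n g) 2 ^ 2
      ≤ ∑ k ∈ Finset.range (n + 1), eLpNorm (weakDeriv k g) 2 ^ 2 := by
    rw [Finset.sum_range_succ]
    exact le_add_self
  have h2 := ENNReal.rpow_le_rpow h1 (by norm_num : (0 : ℝ) ≤ 1 / 2)
  rwa [← ENNReal.rpow_natCast, ← ENNReal.rpow_mul, Nat.cast_ofNat,
    mul_one_div_cancel (two_ne_zero' ℝ), ENNReal.rpow_one] at h2

lemma sq_add_sq_le_sigmaNorm_sq (n : ℕ) (g : ℝ → ℂ) :
    eLpNorm (fun x => japanese x ^ n • g x) 2 ^ 2 + eLpNorm (weakDeriv n g) 2 ^ 2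
      ≤ sigmaNorm n g ^ 2 := by
  have h1 := eLpNorm_weakDeriv_le_sobolevNorm n g
  rw [sigmaNorm]
  generalize eLpNorm (fun x => japanese x ^ n • g x) 2 = p
  generalize eLpNorm (weakDeriv n g) 2 = q at h1 ⊢
  generalize sobolevNorm n g = r at h1 ⊢
  calc p ^ 2 + q ^ 2 ≤ p ^ 2 + r ^ 2 := by gcongr
    _ ≤ p ^ 2 + r ^ 2 + 2 * r * p := le_self_add
    _ = (r + p) ^ 2 := by ring

/-- Consistency of the discrete oscillator with the harmonic oscillator. -/
theorem oscillator_consistency :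
    ∃ (C : ℝ) (N₀ : ℕ), ∀ N : ℕ, N₀ ≤ N → Even N → ∀ h : ℝ, h = mesh N →
      ∀ g : ℝ → ℂ, MemSigma 5 g →
        ell2Norm h (gridProj h (harmonicOscillator g) - discreteOscillator h (gridProj h g))
          ≤ ENNReal.ofReal (C * h ^ 2) * sigmaNorm 5 g := by
  obtain ⟨C, hC, hI⟩ := exists_lintegral_sigmaDensity_le
  -- The root appears because squared norms are compared: `2` is the double covering, `44² · 66` the
  -- local estimate, `C` the interpolation constant.
  refine ⟨√(2 * (44 ^ 2 * 66) * C), 1, fun N hN hNe h hh g hg => ?_⟩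
  obtain ⟨-, -, -, h1⟩ := mesh_eq_of_even hN hNe
  have h0 := mesh_pos hN
  rw [← hh] at h1 h0
  obtain ⟨U, V, hgUV, pU, pV, mU, mV⟩ := hg.exists_chains
  have hU := isChain_of_isPrimitive pU
  have hV := isChain_of_isPrimitive pV
  have hg0 : g =ᵐ[volume] fun x => (U 0 x : ℂ) + V 0 x * Complex.I :=
    (IsWeakDeriv.ae_eq_zero (hg.1.1.locallyIntegrable (by norm_num))
      (hg.1.isWeakDeriv_weakDeriv (Nat.zero_le 5)).1).trans (hgUV 0 (by norm_num))
  refine ell2Norm_le_of_sq_le h0 ?_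
  have hsplit : ∀ k : ℤ, ENNReal.ofReal (h * ‖(gridProj h (harmonicOscillator g)
      - discreteOscillator h (gridProj h g)) (gridEquiv h0 k)‖ ^ 2)
      = ENNReal.ofReal (h * oscillatorError h U (k * h) ^ 2)
        + ENNReal.ofReal (h * oscillatorError h V (k * h) ^ 2) := by
    intro k
    rw [error_eq hg0 (hgUV 2 (by norm_num)) hU hV, coe_gridEquiv, Complex.sq_norm,
      Complex.normSq_add_mul_I, mul_add, ENNReal.ofReal_add (by positivity) (by positivity)]
  simp_rw [hsplit]
  rw [ENNReal.tsum_add]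
  set c := ENNReal.ofReal (2 * (44 ^ 2 * 66 * h ^ 4)) with hc
  calc _ ≤ c * (∫⁻ x, ENNReal.ofReal (sigmaDensity U x))
        + c * ∫⁻ x, ENNReal.ofReal (sigmaDensity V x) :=
        add_le_add (tsum_oscillatorError_le h0 h1 hU) (tsum_oscillatorError_le h0 h1 hV)
    _ ≤ c * (ENNReal.ofReal C *
          ((∫⁻ x, ENNReal.ofReal ((1 + x ^ 2) ^ 5 * (U 0 x * U 0 x)))
            + ∫⁻ x, ENNReal.ofReal (U 5 x * U 5 x)))
        + c * (ENNReal.ofReal C *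
          ((∫⁻ x, ENNReal.ofReal ((1 + x ^ 2) ^ 5 * (V 0 x * V 0 x)))
            + ∫⁻ x, ENNReal.ofReal (V 5 x * V 5 x))) := by
        gcongr
        · exact hI U pU mU
        · exact hI V pV mV
    _ = c * ENNReal.ofReal C *
        (((∫⁻ x, ENNReal.ofReal ((1 + x ^ 2) ^ 5 * (U 0 x * U 0 x)))
            + ∫⁻ x, ENNReal.ofReal ((1 + x ^ 2) ^ 5 * (V 0 x * V 0 x)))
          + ((∫⁻ x, ENNReal.ofReal (U 5 x * U 5 x))
            + ∫⁻ x, ENNReal.ofReal (V 5 x * V 5 x))) := by ring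
    _ ≤ c * ENNReal.ofReal C * sigmaNorm 5 g ^ 2 := by
        rw [sq_eLpNorm_weight hg0 (pU 0 (by norm_num)).continuous,
          sq_eLpNorm_weakDeriv (hgUV 5 le_rfl) (mU 5 le_rfl)]
        gcongr
        exact sq_add_sq_le_sigmaNorm_sq 5 g
    _ = _ := by
        rw [mul_pow, ← ENNReal.ofReal_pow (by positivity), hc,
          ← ENNReal.ofReal_mul (by positivity), mul_pow, Real.sq_sqrt (by positivity)]
        congr 2
        ring

end Kravchuk
theorem theorem2 :
    (∃ (C : ℝ) (N₀ : ℕ), ∀ N : ℕ, N₀ ≤ N → Even N → ∀ h : ℝ, h = Kravchuk.mesh N →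
      ∀ g : ℝ → ℂ, Kravchuk.MemSigma 5 g →
        Kravchuk.ell2Norm h
            (Kravchuk.gridProj h (Kravchuk.harmonicOscillator g)
              - Kravchuk.discreteOscillator h (Kravchuk.gridProj h g))
          ≤ ENNReal.ofReal (C * h ^ 2) * Kravchuk.sigmaNorm 5 g) ∧
    (∀ δ : ℝ, 0 < δ → δ < 1 → ∀ σ : ℝ, 0 ≤ σ →
      ∃ (C : ℝ) (N₀ : ℕ), ∀ N : ℕ, N₀ ≤ N → Even N → ∀ h : ℝ, h = Kravchuk.mesh N →
        Kravchuk.ell2Norm h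
            (fun a => ((Kravchuk.japanese a ^ σ *
              (Kravchuk.rho h a - 1 / √Real.pi * Real.exp (-(a : ℝ) ^ 2)) : ℝ) : ℂ))
          ≤ ENNReal.ofReal (C * h ^ (2 - δ)) ∧
        ∀ n : ℕ, (n : ℝ) ≤ 1 / 3 * δ * |Real.log h| →
          Kravchuk.ell2Norm h
              (fun a => ((Kravchuk.japanese a ^ σ : ℝ) : ℂ) *
                ((Kravchuk.kravchukFun n h a : ℂ)
                  - Kravchuk.gridProj h (fun x => (Kravchuk.hermiteFun n x : ℂ)) a))
            ≤ ENNReal.ofReal (C * h ^ (2 - δ))) := by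
  exact ⟨Kravchuk.oscillator_consistency,
    fun δ hδ0 hδ1 σ _ => Kravchuk.kravchuk_convergence δ hδ0 hδ1 σ⟩
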